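/- Let $N\ge 2$, $0<|q|<1$, and put $(x;q)=\prod_{i\ge 0}(1-xq^i)$, $\theta(x)=(x;q)(q/x;q)$. Let $x,y\in\mathbb C^*$ and $\mathbf a=(a_1,\dots,a_N)$, $\mathbf b=(b_1,\dots,b_N)\in(\mathbb C^*)^N$ with $\prod_i a_i=\prod_i b_i=1$. For $\boldsymbol\xi=(\xi_1,\dots,\xi_N)$ with $\prod_i\xi_i=1$ set $$\mathcal I_{U_N}(\mathbf a,\mathbf b,x)=\prod_{i,j}\frac1{\theta(xa_ib_j)},\qquad \mathcal I_V(\boldsymbol\xi)=(q;q)^{2(N-1)}\prod_{i\ne j}\theta(\xi_i/\xi_j),\qquad \mathcal I_{K_N}(\mathbf a,\mathbf b,x)=\frac{\theta(q/x^N)}{\prod_{i,j}\theta(xa_ib_j)} .$$ **Jeffrey–Kirwan integral.** Let $r=N-1$, with coordinates $z=(\xi_1,\dots,\xi_r)$ on the torus $\prod_i\xi_i=1$. Consider a function $f(z)$ with finitely many factors $1/\theta(c_iz^{Q_i})$, $c_i\in\mathbb C^*$, $Q_i\in\mathbb Z^r$; its singular hypersurfaces are $c_iz^{Q_i}\in q^{\mathbb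 Z}$. The data are *generic* if, at every point $z$, the charges $Q_i$ of the singular hypersurfaces through $z$ are linearly independent. A parameter $\eta\in\mathbb R^r$ is *regular* if it lies in no closed cone spanned by fewer than $r$ of the charges. For generic data and regular $\eta$, $\int_{\rm JK}\prod_{k=1}^r\frac{dz_k}{2\pi i z_k}f(z)$ is the sum, over the points $z_*\in(\mathbb C^*)^r/q^{\mathbb Z^r}$ at which exactly $r$ singular hypersurfaces meet (with charges $Q_{1},\dots,Q_{r}$, say), of the Jeffrey–Kirwan residues $$\frac{1}{|\det(Q_{1},\dots,Q_{r})|}\,\lim_{u\to0}\ f(z_*e^{-u})\prod_{k=1}^rQ_{k}(u)\quad\text{if }\eta\in\operatorname{Cone}(Q_{1},\dots,Q_{r}),\qquad 0\ \text{ otherwise},$$ where the limit is taken off the hyperplanes $Q_k(u)=0$. (In rank one this is the sum of the residues of $f\,d\xi/\xi$ at the poles of the fields of negative charge, or minus the sum over those of positive charge.) The elliptic genus of $\mathcal N=(0,2)$ $SU(N)$ SQCD with $N$ fundamental and $N$ antifundamental flavors is $$\mathcal I(\mathbf a,\mathbf b,x,y)=\frac1{N!}\int_{\rm JK}\prod_{i=1}^{N-1}\frac{d\xi_i}{2\pi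 i\xi_i}\ \mathcal I_{U_N}(\mathbf a,\boldsymbol\xi,x)\,\mathcal I_V(\boldsymbol\xi)\,\mathcal I_{U_N}(\boldsymbol\xi^{-1},\mathbf b,y),$$ with singular hypersurfaces those of the factors $1/\theta(xa_i\xi_j)$ and $1/\theta(yb_j/\xi_i)$. Then the following hold. 1. For generic $(\mathbf a,\mathbf b,x,y)$ this integral is well defined (the integrand is elliptic, i.e. invariant under $q^{\mathbb Z^{N-1}}$; there are finitely many contributing points; the limits exist), and for every regular $\eta$ $$\mathcal I(\mathbf a,\mathbf b,x,y)=\frac{\theta(x^Ny^N)}{\theta(x^N)\,\theta(y^N)\prod_{i,j}\theta(xy\,a_ib_j)} .$$ 2. If $(\mathbf a,\mathbf b,x,y)$ and $(\mathbf a,\mathbf b,y,x)$ are both generic, then $\mathcal I(\mathbf a,\mathbf b,x,y)=\mathcal I(\mathbf a,\mathbf b,y,x)$, for any regular $\eta$ on either side. 3. If the data of the factors $1/\theta(xa_i/\xi_j)$ and $1/\theta(\xi_i/(yb_j))$ are generic, the following integral, whose singular hypersurfaces are those of these factors, is well defined in the same sense, and for every regular $\eta$ $$\frac1{N!}\int_{\rm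 JK}\prod_{i=1}^{N-1}\frac{d\xi_i}{2\pi i\xi_i}\ \mathcal I_{K_N}(\mathbf a,\boldsymbol\xi^{-1},x)\,\mathcal I_V(\boldsymbol\xi)\,\mathcal I_{K_N}(\boldsymbol\xi,\mathbf b^{-1},1/y)=\mathcal I_{K_N}(\mathbf a,\mathbf b^{-1},x/y).$$ -/

import Mathlib

open Filter Topology

noncomputable section

namespace EllipticGenus

/-! ### Theta functions -/

/-- The `q`-Pochhammer symbol `(x;q) = ∏_{i ≥ 0} (1 - x q^i)`. -/
def qPoch (q x : ℂ) : ℂ := ∏' i : ℕ, (1 - x * q ^ i)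

/-- `θ(x;q) = (x;q) (q/x;q)`. -/
def theta (q x : ℂˣ) : ℂ := qPoch q x * qPoch q ((q / x : ℂˣ) : ℂ)

/-! ### Jeffrey–Kirwan integrals over `(ℂˣ)^r / q^(ℤ^r)` -/

/-- The chiral multiplets of a gauge theory with a maximal torus of rank `r`: the multiplet `i` has
gauge charge `charge i` (a weight of the torus) and flavor fugacity `fug i`. Its contribution to the
index is `1 / θ(fug i * z ^ charge i)`. -/
structure ChiralData (r : ℕ) (ι : Type) where
  charge : ι → Fin r → ℤ
  fug : ι → ℂˣ

/-- The lattice `q^(ℤ^r)`; the quotient by it is the space of flat connections of the torus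
`U(1)^r` on the elliptic curve `ℂˣ / q^ℤ`. -/
def qLattice (q : ℂˣ) (r : ℕ) : Subgroup (Fin r → ℂˣ) :=
  Subgroup.pi Set.univ fun _ => Subgroup.zpowers q

/-- The point `z e^{-u}`: `u` is a local logarithmic coordinate at `z`, vanishing at `z`. -/
def expPoint {r : ℕ} (z : Fin r → ℂˣ) (u : Fin r → ℂ) : Fin r → ℂˣ :=
  fun k => z k * Units.mk0 (Complex.exp (-u k)) (Complex.exp_ne_zero _)

namespace ChiralData

variable {r : ℕ} {ι : Type} [Fintype ι]

/-- The argument `fug i * z ^ charge i` of the theta function of the multiplet `i`. -/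
def arg (D : ChiralData r ι) (i : ι) (z : Fin r → ℂˣ) : ℂˣ :=
  D.fug i * ∏ k, z k ^ D.charge i k

/-- The charge as a real covector. -/
def realCharge (D : ChiralData r ι) (i : ι) : Fin r → ℝ := fun k => (D.charge i k : ℝ)

/-- The linear form `u ↦ ⟨charge i, u⟩`. -/
def linForm (D : ChiralData r ι) (i : ι) (u : Fin r → ℂ) : ℂ := ∑ k, (D.charge i k : ℂ) * u k

open Classical in
/-- The multiplets whose singular hypersurface `{z | fug i * z ^ charge i ∈ q^ℤ}` passes
through `z`. -/
def active (q : ℂˣ) (D : ChiralData r ι) (z : Fin r → ℂˣ) : Finset ι :=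
  Finset.univ.filter fun i => ∃ m : ℤ, D.arg i z = q ^ m

/-- The fugacities are generic: the singular hypersurfaces have normal crossings, that is, the
charges of the hypersurfaces through any given point are linearly independent. -/
def Generic (q : ℂˣ) (D : ChiralData r ι) : Prop :=
  ∀ z : Fin r → ℂˣ, LinearIndepOn ℝ D.realCharge (D.active q z : Set ι)

/-- The open cone spanned by the charges in `S`. -/
def openCone (D : ChiralData r ι) (S : Finset ι) : Set (Fin r → ℝ) :=
  {η | ∃ t : ι → ℝ, (∀ i ∈ S, 0 < t i) ∧ η = ∑ i ∈ S, t i • D.realCharge i}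

/-- The closed cone spanned by the charges in `S`. -/
def closedCone (D : ChiralData r ι) (S : Finset ι) : Set (Fin r → ℝ) :=
  {η | ∃ t : ι → ℝ, (∀ i ∈ S, 0 ≤ t i) ∧ η = ∑ i ∈ S, t i • D.realCharge i}

/-- An admissible Jeffrey–Kirwan parameter: `η` lies in no cone spanned by fewer than `r`
charges. -/
def IsRegular (D : ChiralData r ι) (η : Fin r → ℝ) : Prop :=
  ∀ S : Finset ι, S.card < r → η ∉ D.closedCone S

/-- The filter of points `u → 0` off the hyperplanes of the multiplets active at `z`. -/
def nearFilter (q : ℂˣ) (D : ChiralData r ι) (z : Fin r → ℂˣ) : Filter (Fin r → ℂ) :=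
  𝓝[{u | ∀ i ∈ D.active q z, D.linForm i u ≠ 0}] 0

/-- The function `f (z e^{-u}) * ∏ Q_i(u)`, the product running over the multiplets active
at `z`. -/
def cleared (q : ℂˣ) (D : ChiralData r ι) (f : (Fin r → ℂˣ) → ℂ) (z : Fin r → ℂˣ)
    (u : Fin r → ℂ) : ℂ :=
  f (expPoint z u) * ∏ i ∈ D.active q z, D.linForm i u

open Classical in
/-- The Jeffrey–Kirwan residue at `z` of `f`, whose singular hypersurfaces are those of `D` and have
normal crossings. If exactly `r` of them, with charges `Q_1, …, Q_r`, meet at `z`, then in the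
coordinates `u` it is given by
`JK-Res (1 / (Q_1(u) ⋯ Q_r(u))) = 1 / |det (Q_1, …, Q_r)|` if `η ∈ Cone (Q_1, …, Q_r)`, and `0`
otherwise; at the points where fewer of them meet there is no residue. With `z e^{-u}` as the point
with coordinate `u`, in rank one this is the residue of `f dξ/ξ` at the poles of the fields of
negative charge (`η < 0`), and minus that residue at the poles of the fields of positive charge
(`η > 0`). -/
def jkResidue (q : ℂˣ) (D : ChiralData r ι) (η : Fin r → ℝ) (f : (Fin r → ℂˣ) → ℂ)
    (z : Fin r → ℂˣ) : ℂ :=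
  if h : (D.active q z).card = r then
    if η ∈ D.openCone (D.active q z) then
      ((Matrix.of fun j k : Fin r =>
          D.charge ((Finset.equivFinOfCardEq h).symm j : ι) k).det.natAbs : ℂ)⁻¹ *
        limUnder (D.nearFilter q z) (D.cleared q f z)
    else 0
  else 0

/-- The integral `∫_JK ∏ dz_k / (2πi z_k) f(z)`: the sum of the Jeffrey–Kirwan residues of `f` over
the points of `(ℂˣ)^r / q^(ℤ^r)`. -/
def jkIntegral (q : ℂˣ) (D : ChiralData r ι) (η : Fin r → ℝ) (f : (Fin r → ℂˣ) → ℂ) : ℂ :=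
  ∑ᶠ p : (Fin r → ℂˣ) ⧸ qLattice q r, D.jkResidue q η f p.out

/-- The Jeffrey–Kirwan integral of `f` is meaningful: `f` is elliptic, there are finitely many points
of `(ℂˣ)^r / q^(ℤ^r)` at which `r` singular hypersurfaces meet, and at each of them the limit that
defines the residue exists. -/
structure JKWellDefined (q : ℂˣ) (D : ChiralData r ι) (f : (Fin r → ℂˣ) → ℂ) : Prop where
  elliptic : ∀ l ∈ qLattice q r, ∀ z, f (z * l) = f z
  finite : {p : (Fin r → ℂˣ) ⧸ qLattice q r | (D.active q p.out).card = r}.Finite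
  limit : ∀ z, (D.active q z).card = r →
    ∃ L, Tendsto (D.cleared q f z) (D.nearFilter q z) (𝓝 L)

end ChiralData

/-! ### The `SU(N)` theories, `N = n + 1`

The maximal torus of `SU(n+1)` has the coordinates `z = (ξ_1, …, ξ_n)`. -/

/-- `ξ = (ξ_1, …, ξ_n, ξ_{n+1})` with `ξ_1 ⋯ ξ_{n+1} = 1`. -/
def suPoint {n : ℕ} (z : Fin n → ℂˣ) : Fin (n + 1) → ℂˣ := Fin.snoc z (∏ k, z k)⁻¹

/-- The weights of the fundamental representation: `ξ_j = ∏_k z_k ^ (suWeight j k)`. -/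
def suWeight {n : ℕ} (j : Fin (n + 1)) (k : Fin n) : ℤ :=
  if j = Fin.last n then -1 else if j = k.castSucc then 1 else 0

/-- The index of `U_N`: `∏_{i,j} 1 / θ(x a_i b_j)`. -/
def indexU {N : ℕ} (q : ℂˣ) (a b : Fin N → ℂˣ) (x : ℂˣ) : ℂ :=
  ∏ i, ∏ j, 1 / theta q (x * a i * b j)

/-- The index of the `(0,2)` vector multiplet of `SU(n+1)`:
`(q;q)^{2n} ∏_{i ≠ j} θ(ξ_i/ξ_j)`. -/
def indexV {n : ℕ} (q : ℂˣ) (ξ : Fin (n + 1) → ℂˣ) : ℂ :=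
  qPoch q q ^ (2 * n) * ∏ i, ∏ j ∈ Finset.univ.filter (fun j => i ≠ j), theta q (ξ i / ξ j)

/-- The index of the Landau–Ginzburg model `K_N`: `θ(q/x^N) / ∏_{i,j} θ(x a_i b_j)`. -/
def indexK {N : ℕ} (q : ℂˣ) (a b : Fin N → ℂˣ) (x : ℂˣ) : ℂ :=
  theta q (q / x ^ N) / ∏ i, ∏ j, theta q (x * a i * b j)

/-- The chiral multiplets of SQCD: `x a_i ξ_j` (left summand, pair `(i, j)`) and
`y ξ_i⁻¹ b_j` (right summand, pair `(i, j)`). -/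
def sqcdChirals (n : ℕ) (a b : Fin (n + 1) → ℂˣ) (x y : ℂˣ) :
    ChiralData n ((Fin (n + 1) × Fin (n + 1)) ⊕ (Fin (n + 1) × Fin (n + 1))) where
  charge := Sum.elim (fun p => suWeight p.2) (fun p => -suWeight p.1)
  fug := Sum.elim (fun p => x * a p.1) (fun p => y * b p.2)

/-- The integrand `I_U(a, ξ, x) I_V(ξ) I_U(ξ⁻¹, b, y)`. -/
def sqcdIntegrand (q : ℂˣ) (n : ℕ) (a b : Fin (n + 1) → ℂˣ) (x y : ℂˣ) (z : Fin n → ℂˣ) : ℂ :=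
  indexU q a (suPoint z) x * indexV q (suPoint z) * indexU q (suPoint z)⁻¹ b y

/-- The elliptic genus of `(0,2)` `SU(n+1)` SQCD with `n+1` fundamental and `n+1` antifundamental
flavors. -/
def sqcdIndex (q : ℂˣ) (n : ℕ) (a b : Fin (n + 1) → ℂˣ) (x y : ℂˣ) (η : Fin n → ℝ) : ℂ :=
  1 / ((n + 1).factorial : ℂ) *
    (sqcdChirals n a b x y).jkIntegral q η (sqcdIntegrand q n a b x y)

/-- The charged chiral multiplets of two copies of `K_N` glued together: `x a_i ξ_j⁻¹`
(left summand, pair `(i, j)`) and `y⁻¹ ξ_i b_j⁻¹` (right summand, pair `(i, j)`). -/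
def gluedChirals (n : ℕ) (a b : Fin (n + 1) → ℂˣ) (x y : ℂˣ) :
    ChiralData n ((Fin (n + 1) × Fin (n + 1)) ⊕ (Fin (n + 1) × Fin (n + 1))) where
  charge := Sum.elim (fun p => -suWeight p.2) (fun p => suWeight p.1)
  fug := Sum.elim (fun p => x * a p.1) (fun p => y⁻¹ * (b p.2)⁻¹)

/-- The integrand `I_K(a, ξ⁻¹, x) I_V(ξ) I_K(ξ, b⁻¹, 1/y)`. -/
def gluedIntegrand (q : ℂˣ) (n : ℕ) (a b : Fin (n + 1) → ℂˣ) (x y : ℂˣ) (z : Fin n → ℂˣ) : ℂ :=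
  indexK q a (suPoint z)⁻¹ x * indexV q (suPoint z) * indexK q (suPoint z) b⁻¹ (1 / y)

/-- The index of two copies of `K_N` glued with the `SU(n+1)` vector multiplet. -/
def gluedIndex (q : ℂˣ) (n : ℕ) (a b : Fin (n + 1) → ℂˣ) (x y : ℂˣ) (η : Fin n → ℝ) : ℂ :=
  1 / ((n + 1).factorial : ℂ) *
    (gluedChirals n a b x y).jkIntegral q η (gluedIntegrand q n a b x y)

end EllipticGenus

end

/-!
The elliptic genus of SQCD is computed by partial fractions, which turn its Jeffrey–Kirwan integral
into a telescoping sum.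

*Determinants.* With Kronecker's function `kron q t z = θ(tz) / (θ(t) θ(z))`, the Frobenius
determinant `det_kron` evaluates `det (kron q t (x_i y_j))` as a quotient of elliptic Vandermonde
products by `∏ θ(x_i y_j)`. The index of the vector multiplet of `SU(N)`, `N = n + 1`, is a product
of two elliptic Vandermonde products of `ξ` (`prod_roots_eq`), so for auxiliary parameters `t`, `s`
the integrand is a constant times `det (kron q t (x a_i ξ_j)) * det (kron q s (y b_i / ξ_j))`.
Expanding both determinants writes it as a signed sum, over pairs of permutations `σ`, `τ`, of
products `∏_j K_j(ξ_j)`, where `K_j(ξ) = kron q t (x a_{σ j} ξ) * kron q s (y b_{τ j} / ξ)` has simple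
poles only (`sqcdIntegrand_eq`). Each product is elliptic on the torus `ξ_1 ⋯ ξ_N = 1`, because the
multipliers of its factors cancel.

*Poles.* For generic fugacities, `n` singular hypersurfaces meet at a point exactly when they involve
all the coordinates but one, `ξ_{j₀}`, once each (`exists_section`), and they determine the point up
to the lattice (`exists_eq_meetPoint_mul`). A regular `η`, extended by `η_N = 0`, has distinct
coordinates (`extend_injective`). The cone of the charges contains `η` if and only if the sign of the
charge at each `j ≠ j₀` is that of `η_j - η_{j₀}` (`mem_openCone_iff`), and the determinant of the
charges is `±1` (`natAbs_det_charge`).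

*Summation.* In the residue of the product for `σ`, `τ`, only one choice of flavors survives. The
factor at `j ≠ j₀` contributes `kron q s (c_j)` or `kron q t (c_j)`, with `c_j = x a_{σ j} y b_{τ j}`,
according to whether `η_j > η_{j₀}` or not; the factor at `j₀` is regular there, and its partial
fraction expansion (`kron_mul_kron`, a form of Weierstrass' three-term relation) is
`kron q s (c_{j₀}) * kron q (t/s) (·) - kron q t (c_{j₀}) * kron q (t/s) (·)`. Hence the residue is
the difference of the values of one function of subsets of the coordinates at `{j | η_j ≥ η_{j₀}}`
and at `{j | η_j > η_{j₀}}`, and the sum over `j₀` telescopes to the values at the full and at the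
empty set (`sum_termResidue`). Nothing depends on the order of the `η_j` any more. Summed over `σ`
and `τ` these values are again Frobenius determinants, and the three-term relation combines them into
the closed form (`sqcdIndex_eq`).

The triple product identity, from which the three-term relation follows, is obtained as a limit of
its finite form (`hasSum_finite_tripleProduct`). The glued theory is SQCD with the two sets of
flavors exchanged and inverted, up to relabelling its multiplets and a constant factor.
-/

namespace EllipticGenus

/-! ### The theta function -/

lemma summable_norm_mul_pow {q : ℂ} (hq : ‖q‖ < 1) (x : ℂ) :
    Summable fun i : ℕ => ‖-(x * q ^ i)‖ := by
  simp only [norm_neg, norm_mul, norm_pow]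
  exact (summable_geometric_of_lt_one (norm_nonneg _) hq).mul_left _

lemma multipliable_qPoch {q : ℂ} (hq : ‖q‖ < 1) (x : ℂ) :
    Multipliable fun i : ℕ => 1 - x * q ^ i := by
  simpa [sub_eq_add_neg] using multipliable_one_add_of_summable (summable_norm_mul_pow hq x)

lemma qPoch_eq_mul {q : ℂ} (hq : ‖q‖ < 1) (x : ℂ) :
    qPoch q x = (1 - x) * qPoch q (q * x) := by
  have h := (multipliable_qPoch hq (q * x))
  have h2 : ∀ i : ℕ, 1 - q * x * q ^ i = 1 - x * q ^ (i + 1) := fun i => by ring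
  have h3 : ∏' b : ℕ, (1 - x * q ^ b) = (1 - x * q ^ 0) * ∏' b : ℕ, (1 - x * q ^ (b + 1)) :=
    tprod_eq_zero_mul' (h.congr h2)
  unfold qPoch
  rw [h3]
  simp [h2]

lemma qPoch_ne_zero {q : ℂ} (hq : ‖q‖ < 1) {x : ℂ} (h : ∀ i : ℕ, x * q ^ i ≠ 1) :
    qPoch q x ≠ 0 := by
  have := tprod_one_add_ne_zero_of_summable (f := fun i : ℕ => -(x * q ^ i))
    (fun i => by rw [← sub_eq_add_neg, sub_ne_zero]; exact (h i).symm)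
    (summable_norm_mul_pow hq x)
  simpa [sub_eq_add_neg, qPoch] using this

lemma qPoch_self_ne_zero {q : ℂ} (hq : ‖q‖ < 1) : qPoch q q ≠ 0 := by
  refine qPoch_ne_zero hq fun i h => ?_
  have : ‖q * q ^ i‖ < 1 := by
    rw [← pow_succ', norm_pow]
    exact pow_lt_one₀ (norm_nonneg _) hq (by simp)
  simp [h] at this

lemma continuous_qPoch {q : ℂ} (hq : ‖q‖ < 1) : Continuous (qPoch q) := by
  rw [continuous_iff_continuousAt]
  intro x
  have hK : IsOpen (Metric.ball (0 : ℂ) (‖x‖ + 1)) := Metric.isOpen_ball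
  have h := Summable.hasProdLocallyUniformlyOn_one_add (K := Metric.ball (0 : ℂ) (‖x‖ + 1))
    (f := fun (i : ℕ) z => -(z * q ^ i)) hK
    ((summable_geometric_of_lt_one (norm_nonneg _) hq).mul_left (‖x‖ + 1))
    (Eventually.of_forall fun i z hz => by
      rw [norm_neg, norm_mul, norm_pow]
      have : ‖z‖ < ‖x‖ + 1 := by simpa using hz
      gcongr)
    (fun i => by fun_prop)
  have h2 := h.tendstoLocallyUniformlyOn_finsetRange.continuousOn
    (Frequently.of_forall fun n => by fun_prop)
  have h3 := h2.continuousAt (hK.mem_nhds (x := x) (by simp))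
  refine h3.congr (Eventually.of_forall fun z => ?_)
  simp [sub_eq_add_neg, qPoch]

variable {q : ℂˣ}

lemma continuous_theta (hq : ‖(q : ℂ)‖ < 1) : Continuous (theta q) := by
  have h := continuous_qPoch hq
  unfold theta
  have : Continuous fun x : ℂˣ => ((q / x : ℂˣ) : ℂ) :=
    Units.continuous_val.comp (by fun_prop)
  exact (h.comp Units.continuous_val).mul (h.comp this)

lemma theta_ne_zero (hq : ‖(q : ℂ)‖ < 1) {x : ℂˣ} (h : ∀ m : ℤ, x ≠ q ^ m) : theta q x ≠ 0 := by
  refine mul_ne_zero (qPoch_ne_zero hq fun i hi => ?_) (qPoch_ne_zero hq fun i hi => ?_)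
  · refine h (-i) ?_
    have : x * q ^ i = 1 := Units.ext (by simpa using hi)
    rw [zpow_neg, zpow_natCast]
    exact eq_inv_of_mul_eq_one_left this
  · refine h (i + 1) ?_
    have : q / x * q ^ i = 1 := Units.ext (by simpa using hi)
    rw [div_mul_eq_mul_div, div_eq_one] at this
    rw [← this, zpow_add_one, zpow_natCast, mul_comm]

lemma theta_eq (hq : ‖(q : ℂ)‖ < 1) (x : ℂˣ) :
    theta q x = (1 - x) * (qPoch q (q * x) * qPoch q ((q / x : ℂˣ) : ℂ)) := by
  rw [theta, qPoch_eq_mul hq, mul_assoc]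

lemma theta_q_div (x : ℂˣ) : theta q (q / x) = theta q x := by
  simp [theta, mul_comm]

lemma theta_q_mul (hq : ‖(q : ℂ)‖ < 1) (x : ℂˣ) :
    theta q (q * x) = -(x : ℂ)⁻¹ * theta q x := by
  have hx := x.ne_zero
  have hq' := q.ne_zero
  have e1 : ((q / (q * x) : ℂˣ) : ℂ) = (x : ℂ)⁻¹ := by push_cast; field_simp
  have e2 : (q : ℂ) * (x : ℂ)⁻¹ = ((q / x : ℂˣ) : ℂ) := by push_cast; field_simp
  rw [theta_eq hq x, theta, e1, qPoch_eq_mul hq (x : ℂ)⁻¹, e2]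
  push_cast
  field_simp
  ring

lemma theta_one (hq : ‖(q : ℂ)‖ < 1) : theta q 1 = 0 := by simp [theta_eq hq]

lemma theta_zpow_mul_eq_zero_iff (hq : ‖(q : ℂ)‖ < 1) (m : ℤ) (x : ℂˣ) :
    theta q (q ^ m * x) = 0 ↔ theta q x = 0 := by
  induction m with
  | zero => simp
  | succ i ih =>
    rw [← ih, add_comm, zpow_one_add, mul_assoc, theta_q_mul hq]
    simp
  | pred i ih =>
    rw [← ih]
    conv_rhs => rw [show (-(i : ℤ)) = 1 + (-(i : ℤ) - 1) by ring, zpow_one_add, mul_assoc,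
      theta_q_mul hq]
    rw [mul_eq_zero, or_iff_right (neg_ne_zero.2 (inv_ne_zero (Units.ne_zero _)))]

lemma theta_eq_zero_iff (hq : ‖(q : ℂ)‖ < 1) (x : ℂˣ) :
    theta q x = 0 ↔ ∃ m : ℤ, x = q ^ m := by
  constructor
  · intro h
    by_contra! h2
    exact theta_ne_zero hq h2 h
  · rintro ⟨m, rfl⟩
    have := theta_zpow_mul_eq_zero_iff hq m 1
    rw [mul_one] at this
    exact this.2 (theta_one hq)

lemma theta_inv (hq : ‖(q : ℂ)‖ < 1) (x : ℂˣ) : theta q x⁻¹ = -(x : ℂ)⁻¹ * theta q x := by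
  rw [← theta_q_mul hq, ← theta_q_div (q * x)]
  congr 1
  simp

/-! ### The triple product and the three-term relation -/

/-- The series `∑_{k ∈ ℤ} q^(k(k-1)/2) z^k`, up to the sign of `z` the Laurent expansion of `θ`. -/
noncomputable def thetaSeries (q z : ℂ) : ℂ := ∑' k : ℤ, q ^ (k * (k - 1) / 2) * z ^ k

lemma two_mul_choose_two (k : ℤ) : 2 * (k * (k - 1) / 2) = k * (k - 1) :=
  Int.mul_ediv_cancel' (Int.even_mul_pred_self k).two_dvd

lemma summable_nat_thetaSeries {q z : ℂ} (hq0 : q ≠ 0) (hq : ‖q‖ < 1) (hz : z ≠ 0) :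
    Summable fun k : ℕ => ‖q ^ ((k : ℤ) * ((k : ℤ) - 1) / 2) * z ^ (k : ℤ)‖ := by
  refine summable_of_ratio_test_tendsto_lt_one (l := 0) one_pos ?_ ?_
  · exact Eventually.of_forall fun k => by simp [hq0, hz, zpow_ne_zero]
  · have h : ∀ k : ℕ, ‖‖q ^ (((k + 1 : ℕ) : ℤ) * (((k + 1 : ℕ) : ℤ) - 1) / 2)
        * z ^ ((k + 1 : ℕ) : ℤ)‖‖ / ‖‖q ^ ((k : ℤ) * ((k : ℤ) - 1) / 2) * z ^ (k : ℤ)‖‖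
        = ‖q‖ ^ k * ‖z‖ := by
      intro k
      have e : (((k + 1 : ℕ) : ℤ) * (((k + 1 : ℕ) : ℤ) - 1) / 2)
          = (k : ℤ) * ((k : ℤ) - 1) / 2 + k := by
        have h1 := two_mul_choose_two ((k + 1 : ℕ) : ℤ)
        have h2 := two_mul_choose_two (k : ℤ)
        push_cast at h1 h2 ⊢
        linarith
      have := zpow_ne_zero ((k : ℤ) * ((k : ℤ) - 1) / 2) (norm_ne_zero_iff.2 hq0)
      have h3 := norm_ne_zero_iff.2 hz
      rw [e, zpow_add₀ hq0]
      simp only [norm_mul, norm_zpow, norm_norm, zpow_natCast, norm_pow, pow_succ]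
      field_simp
    simp only [h]
    simpa using (tendsto_pow_atTop_nhds_zero_of_lt_one (norm_nonneg _) hq).mul_const ‖z‖

lemma summable_norm_thetaSeries {q z : ℂ} (hq0 : q ≠ 0) (hq : ‖q‖ < 1) (hz : z ≠ 0) :
    Summable fun k : ℤ => ‖q ^ (k * (k - 1) / 2) * z ^ k‖ := by
  refine Summable.of_nat_of_neg (summable_nat_thetaSeries hq0 hq hz) ?_
  refine (summable_nat_thetaSeries hq0 hq (mul_ne_zero hq0 (inv_ne_zero hz))).congr fun k => ?_
  have e : (-(k : ℤ)) * (-(k : ℤ) - 1) / 2 = (k : ℤ) * ((k : ℤ) - 1) / 2 + k := by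
    have h1 := two_mul_choose_two (-(k : ℤ))
    have h2 := two_mul_choose_two (k : ℤ)
    linarith
  rw [e, zpow_add₀ hq0, mul_zpow, inv_zpow, zpow_neg]
  ring_nf

lemma hasSum_thetaSeries {q z : ℂ} (hq0 : q ≠ 0) (hq : ‖q‖ < 1) (hz : z ≠ 0) :
    HasSum (fun k : ℤ => q ^ (k * (k - 1) / 2) * z ^ k) (thetaSeries q z) :=
  (summable_norm_thetaSeries hq0 hq hz).of_norm.hasSum

lemma thetaSeries_q_mul {q z : ℂ} (hq0 : q ≠ 0) (hz : z ≠ 0) :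
    z * thetaSeries q (q * z) = thetaSeries q z := by
  rw [thetaSeries, thetaSeries, ← tsum_mul_left]
  conv_rhs => rw [← (Equiv.addRight (1 : ℤ)).tsum_eq]
  refine tsum_congr fun k => ?_
  have e : (k + 1) * (k + 1 - 1) / 2 = k * (k - 1) / 2 + k := by
    have h1 := two_mul_choose_two (k + 1)
    have h2 := two_mul_choose_two k
    linarith
  simp only [Equiv.coe_addRight]
  rw [e, zpow_add₀ hq0, mul_zpow, zpow_add_one₀ hz]
  ring

/-- The bijection `(k, l) ↦ (k + l, k - l)`, `(k, l) ↦ (k + l + 1, k - l)` of two copies of `ℤ × ℤ`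
onto the pairs of integers with even, respectively odd, sum. -/
lemma bijective_parity : Function.Bijective
    (Sum.elim (fun p => (p.1 + p.2, p.1 - p.2)) (fun p => (p.1 + p.2 + 1, p.1 - p.2)) :
      (ℤ × ℤ) ⊕ (ℤ × ℤ) → ℤ × ℤ) := by
  constructor
  · rintro (⟨a, b⟩ | ⟨a, b⟩) (⟨c, d⟩ | ⟨c, d⟩) h <;>
      simp only [Sum.elim_inl, Sum.elim_inr, Prod.mk.injEq, Sum.inl.injEq, Sum.inr.injEq,
        reduceCtorEq] at h ⊢ <;> omega
  · rintro ⟨m, n⟩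
    rcases Int.even_or_odd' (m + n) with ⟨c, h | h⟩
    · exact ⟨Sum.inl (c, m - c), by simp; omega⟩
    · exact ⟨Sum.inr (c, m - c - 1), by simp; omega⟩

lemma hasSum_thetaSeries_mul {p u v : ℂ} (hp : p ≠ 0) (hp1 : ‖p‖ < 1) (hu : u ≠ 0) (hv : v ≠ 0) :
    HasSum (fun r : ℤ × ℤ => (p ^ (r.1 * (r.1 - 1) / 2) * u ^ r.1) *
      (p ^ (r.2 * (r.2 - 1) / 2) * v ^ r.2)) (thetaSeries p u * thetaSeries p v) := by
  have h := summable_mul_of_summable_norm (f := fun k : ℤ => p ^ (k * (k - 1) / 2) * u ^ k)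
    (g := fun k : ℤ => p ^ (k * (k - 1) / 2) * v ^ k) (summable_norm_thetaSeries hp hp1 hu)
    (summable_norm_thetaSeries hp hp1 hv)
  exact HasSum.mul (f := fun k : ℤ => p ^ (k * (k - 1) / 2) * u ^ k)
    (g := fun k : ℤ => p ^ (k * (k - 1) / 2) * v ^ k) (hasSum_thetaSeries hp hp1 hu)
    (hasSum_thetaSeries hp hp1 hv) h

lemma neg_mul_zpow_mul_neg_div_zpow {x y : ℂ} (hx : x ≠ 0) (hy : y ≠ 0) (k l : ℤ) :
    (-(x * y)) ^ (k + l) * (-(x / y)) ^ (k - l) = (x ^ 2) ^ k * (y ^ 2) ^ l := by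
  have hxy : -(x * y) ≠ 0 := neg_ne_zero.2 (mul_ne_zero hx hy)
  have hxy' : -(x / y) ≠ 0 := neg_ne_zero.2 (div_ne_zero hx hy)
  rw [zpow_add₀ hxy, zpow_sub₀ hxy', div_eq_mul_inv, ← inv_zpow,
    show (-(x * y)) ^ k * (-(x * y)) ^ l * ((-(x / y)) ^ k * (-(x / y))⁻¹ ^ l) =
      ((-(x * y)) ^ k * (-(x / y)) ^ k) * ((-(x * y)) ^ l * (-(x / y))⁻¹ ^ l) by ring,
    ← mul_zpow, ← mul_zpow]
  congr 2 <;> field_simp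

/-- Sorting the terms `(xy)^m (x/y)^n` by the parity of `m + n` decomposes the product. -/
lemma thetaSeries_mul_thetaSeries {q x y : ℂ} (hq0 : q ≠ 0) (hq : ‖q‖ < 1) (hx : x ≠ 0)
    (hy : y ≠ 0) : thetaSeries q (-(x * y)) * thetaSeries q (-(x / y)) =
      thetaSeries (q ^ 2) (x ^ 2) * thetaSeries (q ^ 2) (q * y ^ 2) -
        x / y * (thetaSeries (q ^ 2) (q * x ^ 2) * thetaSeries (q ^ 2) (y ^ 2)) := by
  have hq2 : ‖q ^ 2‖ < 1 := by rw [norm_pow]; exact pow_lt_one₀ (norm_nonneg _) hq two_ne_zero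
  have hq20 : q ^ 2 ≠ 0 := pow_ne_zero _ hq0
  have hxy : -(x * y) ≠ 0 := neg_ne_zero.2 (mul_ne_zero hx hy)
  have h := hasSum_thetaSeries_mul hq0 hq hxy (neg_ne_zero.2 (div_ne_zero hx hy))
  have hE := hasSum_thetaSeries_mul hq20 hq2 (pow_ne_zero 2 hx) (mul_ne_zero hq0 (pow_ne_zero 2 hy))
  have hO := (hasSum_thetaSeries_mul hq20 hq2 (mul_ne_zero hq0 (pow_ne_zero 2 hx))
    (mul_ne_zero hq20 (pow_ne_zero 2 hy))).mul_left (-(x * y))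
  rw [← (Equiv.ofBijective _ bijective_parity).hasSum_iff] at h
  have hq2z : ∀ m : ℤ, (q ^ 2) ^ m = q ^ (2 * m) := fun m => by rw [zpow_mul]; norm_cast
  have h1 := HasSum.sum (f := (fun r : ℤ × ℤ => (q ^ (r.1 * (r.1 - 1) / 2) * (-(x * y)) ^ r.1) *
        (q ^ (r.2 * (r.2 - 1) / 2) * (-(x / y)) ^ r.2)) ∘ (Equiv.ofBijective _ bijective_parity))
    (hE.congr_fun ?_) (hO.congr_fun ?_)
  · rw [h.unique h1, ← thetaSeries_q_mul hq20 (pow_ne_zero 2 hy)]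
    field_simp
    ring
  · rintro ⟨k, l⟩
    simp only [Function.comp_apply, Equiv.ofBijective_apply, Sum.elim_inl]
    have e := two_mul_choose_two (k + l)
    have e1 := two_mul_choose_two (k - l)
    have e2 := two_mul_choose_two k
    have e3 := two_mul_choose_two l
    calc _ = q ^ ((k + l) * (k + l - 1) / 2 + (k - l) * (k - l - 1) / 2) *
          ((-(x * y)) ^ (k + l) * (-(x / y)) ^ (k - l)) := by rw [zpow_add₀ hq0]; ring
      _ = q ^ (2 * (k * (k - 1) / 2) + 2 * (l * (l - 1) / 2) + l) *
          ((x ^ 2) ^ k * (y ^ 2) ^ l) := by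
        rw [neg_mul_zpow_mul_neg_div_zpow hx hy]
        congr 2
        linarith
      _ = _ := by
        rw [hq2z, hq2z, zpow_add₀ hq0, zpow_add₀ hq0, mul_zpow q]
        ring
  · rintro ⟨k, l⟩
    simp only [Function.comp_apply, Equiv.ofBijective_apply, Sum.elim_inr]
    have e := two_mul_choose_two (k + l + 1)
    have e1 := two_mul_choose_two (k - l)
    have e2 := two_mul_choose_two k
    have e3 := two_mul_choose_two l
    calc _ = q ^ ((k + l + 1) * (k + l + 1 - 1) / 2 + (k - l) * (k - l - 1) / 2) *
          (-(x * y) * ((-(x * y)) ^ (k + l) * (-(x / y)) ^ (k - l))) := by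
          rw [zpow_add₀ hq0, zpow_add_one₀ hxy]; ring
      _ = q ^ (2 * (k * (k - 1) / 2) + 2 * (l * (l - 1) / 2) + k + 2 * l) *
          (-(x * y) * ((x ^ 2) ^ k * (y ^ 2) ^ l)) := by
        rw [neg_mul_zpow_mul_neg_div_zpow hx hy]
        congr 2
        linarith
      _ = _ := by
        rw [mul_zpow q, mul_zpow (q ^ 2), hq2z, hq2z, hq2z, zpow_add₀ hq0, zpow_add₀ hq0,
          zpow_add₀ hq0]
        ring

/-- `1 / ((1 - q) ⋯ (1 - q^k))`, extended by `0` to negative `k`, so that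
`invPoch q (k - 1) = (1 - q^k) invPoch q k` for every integer `k`. -/
noncomputable def invPoch (q : ℂ) (k : ℤ) : ℂ :=
  if k < 0 then 0 else (∏ i ∈ Finset.range k.toNat, (1 - q ^ (i + 1)))⁻¹

lemma one_sub_pow_succ_ne_zero {q : ℂ} (hq : ‖q‖ < 1) (i : ℕ) : 1 - q ^ (i + 1) ≠ 0 := by
  intro h
  have h1 : ‖q ^ (i + 1)‖ < 1 := by
    rw [norm_pow]
    exact pow_lt_one₀ (norm_nonneg _) hq (by simp)
  rw [← sub_eq_zero.1 h] at h1
  simp at h1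

lemma invPoch_natCast (q : ℂ) (n : ℕ) :
    invPoch q n = (∏ i ∈ Finset.range n, (1 - q ^ (i + 1)))⁻¹ := by
  simp [invPoch]

lemma invPoch_sub_one {q : ℂ} (hq : ‖q‖ < 1) (k : ℤ) :
    invPoch q (k - 1) = (1 - q ^ k) * invPoch q k := by
  rcases lt_trichotomy k 0 with h | rfl | h
  · rw [invPoch, invPoch, if_pos h, if_pos (by omega), mul_zero]
  · simp [invPoch]
  · obtain ⟨n, rfl⟩ : ∃ n : ℕ, k = (n + 1 : ℕ) := ⟨(k - 1).toNat, by omega⟩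
    have := one_sub_pow_succ_ne_zero hq n
    rw [invPoch_natCast, Finset.prod_range_succ, zpow_natCast,
      show ((n + 1 : ℕ) : ℤ) - 1 = (n : ℕ) by push_cast; ring, invPoch_natCast, mul_inv,
      mul_left_comm, mul_inv_cancel₀ this, mul_one]

lemma thetaTerm_succ {q z : ℂ} (hq0 : q ≠ 0) (hz : z ≠ 0) (k : ℤ) :
    q ^ ((k + 1) * (k + 1 - 1) / 2) * z ^ (k + 1) = z * q ^ k * (q ^ (k * (k - 1) / 2) * z ^ k) := by
  have e : (k + 1) * (k + 1 - 1) / 2 = k * (k - 1) / 2 + k := by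
    have h1 := two_mul_choose_two (k + 1)
    have h2 := two_mul_choose_two k
    linarith
  rw [e, zpow_add₀ hq0, zpow_add_one₀ hz]
  ring

/-- The finite form of the triple product identity, a two-sided `q`-binomial theorem. -/
lemma hasSum_finite_tripleProduct {q x : ℂ} (hq0 : q ≠ 0) (hq : ‖q‖ < 1) (hx : x ≠ 0) (a b : ℕ) :
    HasSum (fun k : ℤ => q ^ (k * (k - 1) / 2) * (-x) ^ k * (invPoch q (b + k) * invPoch q (a - k)))
      ((∏ i ∈ Finset.range a, (1 - x * q ^ i)) * (∏ i ∈ Finset.range b, (1 - q / x * q ^ i)) /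
        ∏ i ∈ Finset.range (a + b), (1 - q ^ (i + 1))) := by
  have hx' : -x ≠ 0 := neg_ne_zero.2 hx
  have hP : ∀ m : ℕ, ∏ i ∈ Finset.range m, (1 - q ^ (i + 1)) ≠ 0 := fun m =>
    Finset.prod_ne_zero_iff.2 fun i _ => one_sub_pow_succ_ne_zero hq i
  induction a with
  | zero =>
    induction b with
    | zero =>
      have h : (fun k : ℤ => q ^ (k * (k - 1) / 2) * (-x) ^ k *
          (invPoch q ((0 : ℕ) + k) * invPoch q ((0 : ℕ) - k))) = fun k => if k = 0 then 1 else 0 := by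
        funext k
        rcases lt_trichotomy k 0 with h | rfl | h
        · rw [if_neg h.ne]; simp [invPoch, h]
        · simp [invPoch]
        · rw [if_neg h.ne']; simp [invPoch, h]
      rw [h]
      simpa using hasSum_ite_eq (0 : ℤ) (1 : ℂ)
    | succ b ih =>
      have h2 := ((Equiv.addRight (1 : ℤ)).hasSum_iff.2 ih).mul_left (q / x * q ^ b)
      have h3 := (ih.sub h2).div_const (1 - q ^ (b + 1))
      have hb := one_sub_pow_succ_ne_zero hq b
      convert! h3 using 1
      · funext k
        have e1 := invPoch_sub_one hq ((b + 1 : ℕ) + k)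
        have e2 := invPoch_sub_one hq (((0 : ℕ) : ℤ) - k)
        rw [show (((b + 1 : ℕ) : ℤ) + k - 1) = b + k by push_cast; ring] at e1
        rw [show ((0 : ℕ) : ℤ) - k - 1 = (0 : ℕ) - (k + 1) by ring] at e2
        simp only [Function.comp_apply, Equiv.coe_addRight]
        rw [show (b : ℤ) + (k + 1) = (b + 1 : ℕ) + k by push_cast; ring, e1, e2,
          thetaTerm_succ hq0 hx', zpow_add₀ hq0, zpow_sub₀ hq0]
        have := zpow_ne_zero k hq0
        simp only [Nat.cast_zero, zpow_zero, zpow_natCast]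
        field_simp
        ring
      · have := hP b
        simp only [Finset.prod_range_succ, zero_add, Finset.prod_range_zero]
        field_simp
  | succ a ih =>
    have h2 := ((Equiv.subRight (1 : ℤ)).hasSum_iff.2 ih).mul_left (x * q ^ a)
    have h3 := (ih.sub h2).div_const (1 - q ^ (a + b + 1))
    have hb := one_sub_pow_succ_ne_zero hq (a + b)
    convert! h3 using 1
    · funext k
      have e1 := invPoch_sub_one hq ((b : ℤ) + k)
      have e2 := invPoch_sub_one hq (((a + 1 : ℕ) : ℤ) - k)
      rw [show ((a + 1 : ℕ) : ℤ) - k - 1 = a - k by push_cast; ring] at e2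
      simp only [Function.comp_apply, Equiv.subRight_apply]
      have e3 := thetaTerm_succ hq0 hx' (k - 1)
      rw [sub_add_cancel] at e3
      rw [e3, show (a : ℤ) - (k - 1) = (a + 1 : ℕ) - k by push_cast; ring,
        show (b : ℤ) + (k - 1) = b + k - 1 by ring, e1, e2, zpow_add₀ hq0, zpow_sub₀ hq0 _ k,
        zpow_sub_one₀ hq0 k]
      have := zpow_ne_zero k hq0
      simp only [zpow_natCast]
      field_simp
      ring
    · have := hP (a + b)
      rw [show a + 1 + b = a + b + 1 by ring]
      simp only [Finset.prod_range_succ]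
      field_simp

lemma exists_norm_invPoch_le {q : ℂ} (hq : ‖q‖ < 1) : ∃ C : ℝ, ∀ k, ‖invPoch q k‖ ≤ C := by
  have h := (multipliable_qPoch hq q).hasProd.tendsto_prod_nat
  have h2 := (h.inv₀ (qPoch_self_ne_zero hq)).norm
  obtain ⟨C, hC⟩ := h2.bddAbove_range
  refine ⟨max C 0, fun k => ?_⟩
  unfold invPoch
  split_ifs with hk
  · simp
  · refine le_max_of_le_left (hC ⟨k.toNat, ?_⟩)
    simp [pow_succ']

lemma tendsto_invPoch {q : ℂ} (hq : ‖q‖ < 1) {g : ℕ → ℤ} (hg : Tendsto g atTop atTop) :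
    Tendsto (fun m => invPoch q (g m)) atTop (𝓝 (qPoch q q)⁻¹) := by
  have h := ((multipliable_qPoch hq q).hasProd.tendsto_prod_nat).inv₀ (qPoch_self_ne_zero hq)
  have h2 : Tendsto (fun m => (g m).toNat) atTop atTop :=
    (tendsto_atTop.2 fun b => (hg.eventually_ge_atTop (b : ℤ)).mono fun m hm => by omega)
  refine (h.comp h2).congr' ?_
  filter_upwards [hg.eventually_ge_atTop 0] with m hm
  simp [invPoch, hm.not_gt, pow_succ']

/-- The Jacobi triple product, `(q;q) θ(x) = ∑_k (-1)^k q^(k(k-1)/2) x^k`. -/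
lemma qPoch_mul_theta {q : ℂˣ} (hq : ‖(q : ℂ)‖ < 1) (x : ℂˣ) :
    qPoch q q * theta q x = thetaSeries q (-x) := by
  have hφ := qPoch_self_ne_zero hq
  obtain ⟨C, hC⟩ := exists_norm_invPoch_le hq
  have h1 : Tendsto (fun m : ℕ => ∑' k : ℤ, (q : ℂ) ^ (k * (k - 1) / 2) * (-(x : ℂ)) ^ k *
      (invPoch q (m + k) * invPoch q (m - k))) atTop
      (𝓝 (∑' k : ℤ, (q : ℂ) ^ (k * (k - 1) / 2) * (-(x : ℂ)) ^ k *
        ((qPoch q q)⁻¹ * (qPoch q q)⁻¹))) := by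
    refine tendsto_tsum_of_dominated_convergence
      (bound := fun k : ℤ => ‖(q : ℂ) ^ (k * (k - 1) / 2) * (-(x : ℂ)) ^ k‖ * (C * C)) ?_ ?_ ?_
    · exact (summable_norm_thetaSeries q.ne_zero hq (neg_ne_zero.2 x.ne_zero)).mul_right _
    · intro k
      refine ((tendsto_invPoch hq ?_).mul (tendsto_invPoch hq ?_)).const_mul _
      · exact tendsto_atTop_add_const_right _ k tendsto_natCast_atTop_atTop
      · exact tendsto_atTop_add_const_right _ (-k) tendsto_natCast_atTop_atTop
    · refine Eventually.of_forall fun m k => ?_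
      rw [norm_mul, norm_mul (invPoch _ _)]
      have := (norm_nonneg _).trans (hC 0)
      gcongr <;> exact hC _
  have h2 : Tendsto (fun m : ℕ => (∏ i ∈ Finset.range m, (1 - (x : ℂ) * q ^ i)) *
      (∏ i ∈ Finset.range m, (1 - (q : ℂ) / x * q ^ i)) /
        ∏ i ∈ Finset.range (m + m), (1 - (q : ℂ) * q ^ i)) atTop
      (𝓝 (qPoch q x * qPoch q (q / x) / qPoch q q)) := by
    have h3 : Tendsto (fun m : ℕ => m + m) atTop atTop := tendsto_id.atTop_add_atTop tendsto_id
    exact ((multipliable_qPoch hq _).hasProd.tendsto_prod_nat.mul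
      (multipliable_qPoch hq _).hasProd.tendsto_prod_nat).div
      ((multipliable_qPoch hq _).hasProd.tendsto_prod_nat.comp h3) hφ
  have h3 := tendsto_nhds_unique (h1.congr fun m => by
    rw [(hasSum_finite_tripleProduct q.ne_zero hq x.ne_zero m m).tsum_eq]
    simp only [pow_succ']) h2
  rw [tsum_mul_right] at h3
  rw [theta, thetaSeries, Units.val_div_eq_div_val]
  field_simp at h3
  rw [h3, mul_assoc]

/-- Weierstrass' three-term relation. The decomposition `thetaSeries_mul_thetaSeries` writes
`θ(xy) θ(x/y)` as a `2 × 2` determinant, and the relation is the Plücker relation for these. -/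
lemma theta_three_term {q : ℂˣ} (hq : ‖(q : ℂ)‖ < 1) (x y u v : ℂˣ) :
    theta q (x * y) * theta q (x / y) * (theta q (u * v) * theta q (u / v)) -
      theta q (x * v) * theta q (x / v) * (theta q (u * y) * theta q (u / y)) =
    u / y * (theta q (y * v) * theta q (y / v) * (theta q (x * u) * theta q (x / u))) := by
  have hφ := qPoch_self_ne_zero hq
  have key : ∀ x y : ℂˣ, theta q (x * y) * theta q (x / y) = (qPoch q q)⁻¹ ^ 2 *
      (thetaSeries (q ^ 2) (x ^ 2) * thetaSeries (q ^ 2) (q * y ^ 2) -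
        x / y * (thetaSeries (q ^ 2) (q * x ^ 2) * thetaSeries (q ^ 2) (y ^ 2))) := by
    intro x y
    rw [← thetaSeries_mul_thetaSeries q.ne_zero hq x.ne_zero y.ne_zero, ← Units.val_mul,
      ← Units.val_div_eq_div_val, ← qPoch_mul_theta hq, ← qPoch_mul_theta hq]
    field_simp
  have := x.ne_zero
  have := y.ne_zero
  have := u.ne_zero
  have := v.ne_zero
  simp only [key]
  field_simp
  ring

/-! ### Kronecker's function and Fay's identity -/

lemma exists_sq_eq_unit (t : ℂˣ) : ∃ s : ℂˣ, s ^ 2 = t := by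
  obtain ⟨s, hs⟩ := IsAlgClosed.exists_pow_nat_eq (t : ℂ) two_pos
  have h0 : s ≠ 0 := by
    rintro rfl
    exact t.ne_zero (by simpa using hs.symm)
  exact ⟨Units.mk0 s h0, Units.ext (by simpa using hs)⟩

/-- Kronecker's function `θ(tz) / (θ(t) θ(z))`: as a function of `z` it has a simple pole along
`q^ℤ` and the multiplier `t⁻¹` under `z ↦ qz`. -/
noncomputable def kron (q t z : ℂˣ) : ℂ := theta q (t * z) / (theta q t * theta q z)

lemma kron_q_mul (hq : ‖(q : ℂ)‖ < 1) (t z : ℂˣ) :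
    kron q t (q * z) = (t : ℂ)⁻¹ * kron q t z := by
  have hz := z.ne_zero
  rw [kron, kron, mul_left_comm, theta_q_mul hq, theta_q_mul hq, Units.val_mul, mul_inv, neg_mul,
    neg_mul, mul_neg, neg_div_neg_eq]
  rw [show (t : ℂ)⁻¹ * (z : ℂ)⁻¹ * theta q (t * z) / (theta q t * ((z : ℂ)⁻¹ * theta q z)) =
    ((z : ℂ)⁻¹ * ((t : ℂ)⁻¹ * theta q (t * z))) / ((z : ℂ)⁻¹ * (theta q t * theta q z)) by ring,
    mul_div_mul_left _ _ (inv_ne_zero hz), mul_div_assoc]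

lemma kron_zpow_mul (hq : ‖(q : ℂ)‖ < 1) (t z : ℂˣ) (m : ℤ) :
    kron q t (q ^ m * z) = (t : ℂ) ^ (-m) * kron q t z := by
  have ht := t.ne_zero
  induction m with
  | zero => simp
  | succ i ih =>
    rw [add_comm, zpow_one_add, mul_assoc, kron_q_mul hq, ih, neg_add, zpow_add₀ ht, zpow_neg_one,
      mul_assoc]
  | pred i ih =>
    have h := kron_q_mul hq t (q ^ (-(i : ℤ) - 1) * z)
    rw [← mul_assoc, ← zpow_one_add, add_sub_cancel, ih] at h
    rw [neg_neg] at h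
    rw [neg_sub, sub_neg_eq_add, zpow_one_add₀ ht, mul_assoc, h, mul_inv_cancel_left₀ ht]

/-- Fay's identity: the three-term relation in the variables of Kronecker's function. -/
lemma theta_fay (hq : ‖(q : ℂ)‖ < 1) (t s X Y : ℂˣ) :
    theta q (X * Y) * theta q (t * X) * theta q (s * Y) * theta q (t / s) =
      theta q (s * (X * Y)) * theta q (t / s * X) * theta q t * theta q Y +
        Y * (theta q (t * (X * Y)) * theta q (t / s * Y⁻¹) * theta q s * theta q X) := by
  obtain ⟨T, rfl⟩ := exists_sq_eq_unit t
  obtain ⟨R, rfl⟩ := exists_sq_eq_unit Y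
  have h := theta_three_term hq (T * X * R) (T / R) (T * R) (s * R / T)
  have e1 : T * X * R * (T / R) = T ^ 2 * X := by ext; push_cast; field_simp
  have e2 : T * X * R / (T / R) = X * R ^ 2 := by ext; push_cast; field_simp
  have e3 : T * R * (s * R / T) = s * R ^ 2 := by ext; push_cast; field_simp
  have e4 : T * R / (s * R / T) = T ^ 2 / s := by ext; push_cast; field_simp
  have e5 : T * X * R * (s * R / T) = s * (X * R ^ 2) := by ext; push_cast; field_simp
  have e6 : T * X * R / (s * R / T) = T ^ 2 / s * X := by ext; push_cast; field_simp
  have e7 : T * R * (T / R) = T ^ 2 := by ext; push_cast; field_simp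
  have e8 : T * R / (T / R) = R ^ 2 := by ext; push_cast; field_simp
  have e9 : T / R * (s * R / T) = s := by ext; push_cast; field_simp
  have e10 : T / R / (s * R / T) = T ^ 2 / s * (R ^ 2)⁻¹ := by ext; push_cast; field_simp
  have e11 : T * X * R * (T * R) = T ^ 2 * (X * R ^ 2) := by ext; push_cast; field_simp
  have e12 : T * X * R / (T * R) = X := by ext; push_cast; field_simp
  have e13 : ((T * R : ℂˣ) : ℂ) / ((T / R : ℂˣ) : ℂ) = ((R ^ 2 : ℂˣ) : ℂ) := by
    rw [← Units.val_div_eq_div_val, e8]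
  rw [e1, e2, e3, e4, e5, e6, e7, e8, e9, e10, e11, e12, e13] at h
  linear_combination h

/-- The partial fraction expansion `kron_mul_kron` multiplied by `θ(XY)`, which may vanish here. -/
lemma theta_mul_kron_mul_kron (hq : ‖(q : ℂ)‖ < 1) {t s X Y : ℂˣ} (ht : theta q t ≠ 0)
    (hs : theta q s ≠ 0) (hts : theta q (t / s) ≠ 0) (hX : theta q X ≠ 0) (hY : theta q Y ≠ 0) :
    theta q (X * Y) * (kron q t X * kron q s Y) =
      theta q (s * (X * Y)) / theta q s * kron q (t / s) X -
        theta q (t * (X * Y)) / theta q t * kron q (t / s) Y⁻¹ := by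
  have h := theta_fay hq t s X Y
  have hY' := Y.ne_zero
  simp only [kron, theta_inv hq Y]
  field_simp
  linear_combination h

/-- The partial fraction expansion of a product of two Kronecker functions. -/
lemma kron_mul_kron (hq : ‖(q : ℂ)‖ < 1) {t s X Y : ℂˣ} (ht : theta q t ≠ 0)
    (hs : theta q s ≠ 0) (hts : theta q (t / s) ≠ 0) (hX : theta q X ≠ 0) (hY : theta q Y ≠ 0)
    (hXY : theta q (X * Y) ≠ 0) :
    kron q t X * kron q s Y =
      kron q s (X * Y) * kron q (t / s) X - kron q t (X * Y) * kron q (t / s) Y⁻¹ := by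
  have h := theta_mul_kron_mul_kron hq ht hs hts hX hY
  have e1 : theta q (X * Y) * kron q s (X * Y) = theta q (s * (X * Y)) / theta q s := by
    rw [kron]; field_simp
  have e2 : theta q (X * Y) * kron q t (X * Y) = theta q (t * (X * Y)) / theta q t := by
    rw [kron]; field_simp
  rw [← mul_right_inj' hXY, h, ← e1, ← e2]
  ring

/-! ### The Frobenius determinant -/

/-- The case of `2 × 2` matrices of the Frobenius determinant, without denominators. -/
lemma theta_frobenius_two (hq : ‖(q : ℂ)‖ < 1) (t x₁ x₂ y₁ y₂ : ℂˣ) :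
    theta q (t * (x₁ * y₁)) * theta q (t * (x₂ * y₂)) * theta q (x₁ * y₂) * theta q (x₂ * y₁) -
      theta q (t * (x₁ * y₂)) * theta q (t * (x₂ * y₁)) * theta q (x₁ * y₁) * theta q (x₂ * y₂) =
    theta q t * theta q (t * (x₁ * y₁) * (x₂ * y₂)) * (x₂ * theta q (x₁ / x₂)) *
      (y₂ * theta q (y₁ / y₂)) := by
  obtain ⟨T, rfl⟩ := exists_sq_eq_unit t
  obtain ⟨R, rfl⟩ := exists_sq_eq_unit y₁
  obtain ⟨S, rfl⟩ := exists_sq_eq_unit y₂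
  have h := theta_three_term hq (T * R * S * x₁) (T * R / S) (T * R * S * x₂) (T * S / R)
  have e1 : T * R * S * x₁ * (T * R / S) = T ^ 2 * (x₁ * R ^ 2) := by
    ext; push_cast; field_simp
  have e2 : T * R * S * x₁ / (T * R / S) = x₁ * S ^ 2 := by ext; push_cast; field_simp
  have e3 : T * R * S * x₂ * (T * S / R) = T ^ 2 * (x₂ * S ^ 2) := by
    ext; push_cast; field_simp
  have e4 : T * R * S * x₂ / (T * S / R) = x₂ * R ^ 2 := by ext; push_cast; field_simp
  have e5 : T * R * S * x₁ * (T * S / R) = T ^ 2 * (x₁ * S ^ 2) := by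
    ext; push_cast; field_simp
  have e6 : T * R * S * x₁ / (T * S / R) = x₁ * R ^ 2 := by ext; push_cast; field_simp
  have e7 : T * R * S * x₂ * (T * R / S) = T ^ 2 * (x₂ * R ^ 2) := by
    ext; push_cast; field_simp
  have e8 : T * R * S * x₂ / (T * R / S) = x₂ * S ^ 2 := by ext; push_cast; field_simp
  have e9 : T * R / S * (T * S / R) = T ^ 2 := by ext; push_cast; field_simp
  have e10 : T * R / S / (T * S / R) = R ^ 2 / S ^ 2 := by ext; push_cast; field_simp
  have e11 : T * R * S * x₁ * (T * R * S * x₂) = T ^ 2 * (x₁ * R ^ 2) * (x₂ * S ^ 2) := by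
    ext; push_cast; field_simp
  have e12 : T * R * S * x₁ / (T * R * S * x₂) = x₁ / x₂ := by ext; push_cast; field_simp
  have e13 : ((T * R * S * x₂ : ℂˣ) : ℂ) / ((T * R / S : ℂˣ) : ℂ) =
      (x₂ : ℂ) * ((S ^ 2 : ℂˣ) : ℂ) := by
    rw [← Units.val_div_eq_div_val, e8, Units.val_mul]
  rw [e1, e2, e3, e4, e5, e6, e7, e8, e9, e10, e11, e12, e13] at h
  linear_combination h

/-- The elliptic Vandermonde product `∏_{i < j} x_j θ(x_i / x_j)`. -/
noncomputable def ellVandermonde (q : ℂˣ) {m : ℕ} (x : Fin m → ℂˣ) : ℂ :=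
  ∏ i, ∏ j ∈ Finset.Ioi i, ((x j : ℂ) * theta q (x i / x j))

lemma ellVandermonde_succ {m : ℕ} (x : Fin (m + 1) → ℂˣ) :
    ellVandermonde q x = (∏ j : Fin m, ((x j.succ : ℂ) * theta q (x 0 / x j.succ))) *
      ellVandermonde q fun i => x i.succ := by
  rw [ellVandermonde, Fin.prod_univ_succ, Fin.prod_Ioi_zero]
  simp only [Fin.prod_Ioi_succ, ellVandermonde]

lemma ellVandermonde_ne_zero {m : ℕ} {x : Fin m → ℂˣ}
    (h : ∀ i j, i ≠ j → theta q (x i / x j) ≠ 0) : ellVandermonde q x ≠ 0 :=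
  Finset.prod_ne_zero_iff.2 fun i _ => Finset.prod_ne_zero_iff.2 fun j hj =>
    mul_ne_zero (x j).ne_zero (h i j (Finset.mem_Ioi.1 hj).ne)

/-- The product over the roots splits into two elliptic Vandermonde products. -/
lemma prod_roots_eq {m : ℕ} (x : Fin m → ℂˣ) :
    ∏ i, ∏ j ∈ Finset.univ.filter (fun j => i ≠ j), theta q (x i / x j) =
      ellVandermonde q x * ellVandermonde q x⁻¹ := by
  have h1 : ∀ i : Fin m, Finset.univ.filter (fun j => i ≠ j) = Finset.Ioi i ∪ Finset.Iio i := by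
    intro i
    ext j
    simp only [Finset.mem_filter, Finset.mem_univ, true_and, Finset.mem_union, Finset.mem_Ioi,
      Finset.mem_Iio]
    exact lt_or_lt_iff_ne.symm
  have h2 : ∀ i : Fin m, Disjoint (Finset.Ioi i) (Finset.Iio i) := fun i =>
    Finset.disjoint_left.2 fun j hj hj' =>
      lt_asymm (Finset.mem_Ioi.1 hj) (Finset.mem_Iio.1 hj')
  have h3 : ∏ i : Fin m, ∏ j ∈ Finset.Iio i, theta q (x i / x j) =
      ∏ j : Fin m, ∏ i ∈ Finset.Ioi j, theta q (x i / x j) :=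
    Finset.prod_comm' (by simp)
  simp only [h1, Finset.prod_union (h2 _), Finset.prod_mul_distrib, h3, ellVandermonde]
  have h4 : (∏ i : Fin m, ∏ j ∈ Finset.Ioi i, (x j : ℂ)) *
      ∏ i : Fin m, ∏ j ∈ Finset.Ioi i, ((x⁻¹ j : ℂˣ) : ℂ) = 1 := by
    simp only [← Finset.prod_mul_distrib, Pi.inv_apply, Units.mul_inv, Finset.prod_const_one]
  have h5 : ∏ i : Fin m, ∏ j ∈ Finset.Ioi i, theta q (x⁻¹ i / x⁻¹ j) =
      ∏ i : Fin m, ∏ j ∈ Finset.Ioi i, theta q (x j / x i) := by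
    simp only [Pi.inv_apply, inv_div_inv]
  rw [h5]
  linear_combination (-(∏ i : Fin m, ∏ j ∈ Finset.Ioi i, theta q (x i / x j)) *
    ∏ i : Fin m, ∏ j ∈ Finset.Ioi i, theta q (x j / x i)) * h4

/-- The Frobenius determinant for generic `t`, by induction: the Schur complement of the first entry
is again a Kronecker matrix, with parameter `t x₀ y₀`, up to scaling of rows and columns. -/
lemma det_kron_of_generic (hq : ‖(q : ℂ)‖ < 1) {m : ℕ} (x y : Fin m → ℂˣ)
    (h : ∀ i j, theta q (x i * y j) ≠ 0) (t : ℂˣ)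
    (ht : ∀ S : Finset (Fin m), theta q (t * ∏ i ∈ S, (x i * y i)) ≠ 0) :
    (Matrix.of fun i j => kron q t (x i * y j)).det =
      theta q (t * ((∏ i, x i) * ∏ i, y i)) / theta q t *
        (ellVandermonde q x * ellVandermonde q y) / ∏ i, ∏ j, theta q (x i * y j) := by
  induction m generalizing t with
  | zero =>
    have := ht ∅
    simp only [Finset.prod_empty, mul_one] at this
    simp [ellVandermonde, this]
  | succ m ih =>
    have ht0 : theta q t ≠ 0 := by simpa using ht ∅
    have ht1 : theta q (t * (x 0 * y 0)) ≠ 0 := by simpa using ht {0}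
    have hk : kron q t (x 0 * y 0) ≠ 0 := div_ne_zero ht1 (mul_ne_zero ht0 (h 0 0))
    set r : Fin m → ℂ := fun i =>
      ((x i.succ : ℂ) * theta q (x 0 / x i.succ)) / theta q (x i.succ * y 0) with hr
    set c : Fin m → ℂ := fun j =>
      ((y j.succ : ℂ) * theta q (y 0 / y j.succ)) / theta q (x 0 * y j.succ) with hc
    have schur : ∀ i j : Fin m, kron q t (x i.succ * y j.succ) -
        kron q t (x i.succ * y 0) / kron q t (x 0 * y 0) * kron q t (x 0 * y j.succ) =
        r i * (c j * kron q (t * (x 0 * y 0)) (x i.succ * y j.succ)) := by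
      intro i j
      have h1 := h 0 0
      have h2 := h i.succ 0
      have h3 := h 0 j.succ
      have h4 := h i.succ j.succ
      have h5 := theta_frobenius_two hq t (x 0) (x i.succ) (y 0) (y j.succ)
      simp only [hr, hc, kron]
      field_simp
      linear_combination h5
    set B : Matrix (Fin (m + 1)) (Fin (m + 1)) ℂ := Matrix.of fun i j => if i = 0 then
      kron q t (x 0 * y j) else kron q t (x i * y j) -
        kron q t (x i * y 0) / kron q t (x 0 * y 0) * kron q t (x 0 * y j) with hB
    have hdet : (Matrix.of fun i j => kron q t (x i * y j)).det = B.det := by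
      refine Matrix.det_eq_of_forall_row_eq_smul_add_const
        (fun i => if i = 0 then 0 else kron q t (x i * y 0) / kron q t (x 0 * y 0)) 0 (by simp)
        fun i j => ?_
      by_cases hi : i = 0
      · simp [hB, hi]
      · simp [hB, hi]
    have hsub : B.submatrix (Fin.succAbove 0) Fin.succ = Matrix.of fun i j => r i *
        (Matrix.of fun i j => c j *
          (Matrix.of fun i j => kron q (t * (x 0 * y 0)) (x (Fin.succ i) * y (Fin.succ j))) i j)
            i j := by
      ext i j
      simp only [hB, Matrix.submatrix_apply, Fin.succAbove_zero, Matrix.of_apply, Fin.succ_ne_zero,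
        if_false]
      exact schur i j
    have hB0 : ∀ i : Fin m, B i.succ 0 = 0 := by
      intro i
      simp [hB, Fin.succ_ne_zero, hk]
    have hB00 : B 0 0 = kron q t (x 0 * y 0) := by simp [hB]
    rw [hdet, Matrix.det_succ_column_zero, Fin.sum_univ_succ]
    simp only [hB0, mul_zero, zero_mul, Finset.sum_const_zero, add_zero, hB00, Fin.val_zero,
      pow_zero, one_mul]
    rw [hsub, Matrix.det_mul_column, Matrix.det_mul_row,
      ih (fun i => x i.succ) (fun i => y i.succ) (fun i j => h _ _) (t * (x 0 * y 0)) (fun S => ?_)]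
    · rw [ellVandermonde_succ, ellVandermonde_succ]
      have e1 : t * (x 0 * y 0) * ((∏ i : Fin m, x i.succ) * ∏ i : Fin m, y i.succ) =
          t * ((∏ i, x i) * ∏ i, y i) := by
        rw [Fin.prod_univ_succ, Fin.prod_univ_succ, mul_assoc, mul_mul_mul_comm]
      have e2 : ∏ i, ∏ j, theta q (x i * y j) = theta q (x 0 * y 0) *
          (∏ j : Fin m, theta q (x 0 * y j.succ)) * (∏ i : Fin m, theta q (x i.succ * y 0)) *
          ∏ i : Fin m, ∏ j : Fin m, theta q (x i.succ * y j.succ) := by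
        simp only [Fin.prod_univ_succ, Finset.prod_mul_distrib]
        ring
      have n1 : ∏ j : Fin m, theta q (x 0 * y j.succ) ≠ 0 :=
        Finset.prod_ne_zero_iff.2 fun _ _ => h _ _
      have n2 : ∏ j : Fin m, theta q (x j.succ * y 0) ≠ 0 :=
        Finset.prod_ne_zero_iff.2 fun _ _ => h _ _
      have n3 : ∏ i : Fin m, ∏ j : Fin m, theta q (x i.succ * y j.succ) ≠ 0 :=
        Finset.prod_ne_zero_iff.2 fun _ _ => Finset.prod_ne_zero_iff.2 fun _ _ => h _ _
      have n4 := h 0 0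
      rw [e1, e2, kron]
      simp only [hr, hc, Finset.prod_div_distrib]
      field_simp
    · have := ht (insert 0 (S.map (Fin.succEmb m)))
      rw [Finset.prod_insert (by simp [Fin.succ_ne_zero]), Finset.prod_map] at this
      simpa [mul_assoc] using this

/-- The point `t e^u` of the ray through `t`. -/
noncomputable def expRay (t : ℂˣ) (u : ℝ) : ℂˣ :=
  t * Units.mk0 (Complex.exp u) (Complex.exp_ne_zero _)

lemma continuous_mk0_exp {X : Type*} [TopologicalSpace X] {f : X → ℂ} (hf : Continuous f) :
    Continuous fun u => Units.mk0 (Complex.exp (f u)) (Complex.exp_ne_zero _) := by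
  rw [Units.isEmbedding_val₀.continuous_iff]
  exact Complex.continuous_exp.comp hf

lemma countable_theta_expRay (hq : ‖(q : ℂ)‖ < 1) (t : ℂˣ) :
    {u : ℝ | theta q (expRay t u) = 0}.Countable := by
  have h : {u : ℝ | theta q (expRay t u) = 0} = ⋃ m : ℤ, {u : ℝ | expRay t u = q ^ m} := by
    ext u
    simp [theta_eq_zero_iff hq]
  rw [h]
  refine Set.countable_iUnion fun m => Set.Subsingleton.countable fun u hu v hv => ?_
  have h1 : expRay t u = expRay t v := hu.trans hv.symm
  have h2 := congrArg Units.val (mul_left_cancel h1)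
  simp only [Units.val_mk0] at h2
  exact Real.exp_injective (by exact_mod_cast h2)

/-- The Frobenius determinant
`det (θ(t x_i y_j) / (θ(t) θ(x_i y_j))) = θ(t ∏ x ∏ y) / θ(t) ⬝ V(x) V(y) / ∏ θ(x_i y_j)`. -/
lemma det_kron (hq : ‖(q : ℂ)‖ < 1) {m : ℕ} (x y : Fin m → ℂˣ)
    (h : ∀ i j, theta q (x i * y j) ≠ 0) {t : ℂˣ} (ht : theta q t ≠ 0) :
    (Matrix.of fun i j => kron q t (x i * y j)).det =
      theta q (t * ((∏ i, x i) * ∏ i, y i)) / theta q t *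
        (ellVandermonde q x * ellVandermonde q y) / ∏ i, ∏ j, theta q (x i * y j) := by
  have hdet : ∀ t : ℂˣ, theta q t ≠ 0 →
      (Matrix.of fun i j => theta q (t * (x i * y j)) / theta q (x i * y j)).det =
      theta q t ^ m * (Matrix.of fun i j => kron q t (x i * y j)).det := by
    intro t ht
    have := Matrix.det_smul (Matrix.of fun i j => kron q t (x i * y j)) (theta q t)
    rw [Fintype.card_fin] at this
    rw [← this]
    congr 1
    ext i j
    simp only [Matrix.of_apply, Matrix.smul_apply, smul_eq_mul, kron]
    field_simp
  -- After clearing the denominators both sides are continuous along the ray through `t`, and the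
  -- parameters excluded by `det_kron_of_generic` form a countable set there.
  have hray : ∀ c : ℂˣ, Continuous fun u : ℝ => theta q (expRay t u * c) := fun c =>
    (continuous_theta hq).comp
      ((continuous_const.mul (continuous_mk0_exp Complex.continuous_ofReal)).mul continuous_const)
  have hray' : Continuous fun u : ℝ => theta q (expRay t u) := by simpa using hray 1
  have hdense : Dense (⋃ S : Finset (Fin m),
      {u : ℝ | theta q (expRay (t * ∏ i ∈ S, (x i * y i)) u) = 0})ᶜ :=
    Set.Countable.dense_compl ℝ (Set.countable_iUnion fun S => countable_theta_expRay hq _)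
  have key := Continuous.ext_on hdense
    (f := fun u => (Matrix.of fun i j =>
      theta q (expRay t u * (x i * y j)) / theta q (x i * y j)).det * theta q (expRay t u))
    (g := fun u => theta q (expRay t u) ^ m * (theta q (expRay t u * ((∏ i, x i) * ∏ i, y i)) *
        (ellVandermonde q x * ellVandermonde q y) / ∏ i, ∏ j, theta q (x i * y j)))
    ((Continuous.matrix_det (continuous_matrix fun i j => (hray _).div_const _)).mul hray')
    ((hray'.pow m).mul (((hray _).mul_const _).div_const _))
    (fun u hu => by
      simp only [Set.mem_compl_iff, Set.mem_iUnion, Set.mem_ofPred_eq, not_exists] at hu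
      have hg : ∀ S : Finset (Fin m), theta q (expRay t u * ∏ i ∈ S, (x i * y i)) ≠ 0 := by
        intro S
        have := hu S
        rwa [expRay, mul_right_comm] at this
      have h0 : theta q (expRay t u) ≠ 0 := by simpa using hg ∅
      simp only
      rw [hdet _ h0, det_kron_of_generic hq x y h _ hg]
      field_simp)
  have k0 := congrFun key 0
  have e0 : expRay t 0 = t := by ext; simp [expRay]
  simp only [e0] at k0
  rw [hdet t ht] at k0
  have := pow_ne_zero m ht
  field_simp
  apply mul_left_cancel₀ this
  rw [← mul_assoc, mul_comm _ (theta q t), mul_comm (theta q t), k0]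
  ring

variable {n : ℕ}

/-! ### The weights of `SU(n+1)` -/

lemma prod_suPoint (z : Fin n → ℂˣ) : ∏ j, suPoint z j = 1 := by
  rw [suPoint, Fin.prod_snoc, mul_inv_cancel]

lemma suPoint_castSucc (z : Fin n → ℂˣ) (k : Fin n) : suPoint z k.castSucc = z k := by
  simp [suPoint]

lemma suPoint_eq {ξ : Fin (n + 1) → ℂˣ} (h : ∏ j, ξ j = 1) :
    suPoint (fun k : Fin n => ξ k.castSucc) = ξ := by
  rw [Fin.prod_univ_castSucc] at h
  funext j
  refine Fin.lastCases ?_ (fun k => ?_) j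
  · rw [suPoint, Fin.snoc_last]
    exact (eq_inv_of_mul_eq_one_right h).symm
  · rw [suPoint_castSucc]

lemma suWeight_eq (j : Fin (n + 1)) (k : Fin n) :
    suWeight j k = (if j = k.castSucc then 1 else 0) - (if j = Fin.last n then 1 else 0) := by
  unfold suWeight
  by_cases h : j = Fin.last n
  · simp [h, (Fin.castSucc_lt_last k).ne']
  · simp [h]

lemma prod_zpow_suWeight {G : Type*} [CommGroup G] (z : Fin n → G) (j : Fin (n + 1)) :
    ∏ k, z k ^ suWeight j k = Fin.snoc (α := fun _ => G) z (∏ k, z k)⁻¹ j := by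
  refine Fin.lastCases ?_ (fun l => ?_) j
  · simp [suWeight]
  · simp [suWeight_eq, Finset.prod_ite_eq]

/-- Since the weights sum to zero, the coordinates of `v` may be shifted by a common constant. -/
lemma sum_mul_suWeight {R : Type*} [CommRing R] (v : Fin (n + 1) → R) (c : R) (k : Fin n) :
    ∑ j, (v j - c) * (suWeight j k : R) = v k.castSucc - v (Fin.last n) := by
  simp [suWeight_eq, mul_sub, Finset.sum_sub_distrib]

/-! ### The multiplets of SQCD -/

/-- The chiral multiplets of SQCD: fundamental (left) and antifundamental (right). -/
abbrev Mult (n : ℕ) : Type := (Fin (n + 1) × Fin (n + 1)) ⊕ (Fin (n + 1) × Fin (n + 1))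

/-- The index `j` of the coordinate `ξ_j` on which a multiplet depends. -/
def Mult.label : Mult n → Fin (n + 1) := Sum.elim Prod.snd Prod.fst

/-- The sign of the charge of a multiplet. -/
def Mult.sign : Mult n → ℤ := Sum.elim (fun _ => 1) (fun _ => -1)

/-- The flavor index of a multiplet. -/
def Mult.flavor : Mult n → Fin (n + 1) := Sum.elim Prod.fst Prod.snd

/-- The multiplet with positive (`p = true`) or negative charge, flavor `i` and label `j`. -/
def Mult.mk (p : Bool) (i j : Fin (n + 1)) : Mult n := if p then Sum.inl (i, j) else Sum.inr (j, i)

/-- The singular hypersurface of the multiplet `i` is `ξ_j ∈ pole i * q^ℤ`, with `j` its label. -/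
def Mult.pole (a b : Fin (n + 1) → ℂˣ) (x y : ℂˣ) : Mult n → ℂˣ :=
  Sum.elim (fun p => (x * a p.1)⁻¹) (fun p => y * b p.2)

@[simp] lemma Mult.label_mk (p : Bool) (i j : Fin (n + 1)) : (Mult.mk p i j).label = j := by
  cases p <;> rfl

@[simp] lemma Mult.flavor_mk (p : Bool) (i j : Fin (n + 1)) : (Mult.mk p i j).flavor = i := by
  cases p <;> rfl

lemma Mult.sign_mk (p : Bool) (i j : Fin (n + 1)) :
    (Mult.mk p i j).sign = if p then 1 else -1 := by
  cases p <;> rfl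

lemma Mult.mk_eta (i : Mult n) {p : Bool} (hp : 0 < i.sign ↔ p = true) :
    Mult.mk p i.flavor i.label = i := by
  rcases i with ⟨i, j⟩ | ⟨i, j⟩ <;> cases p <;> simp [Mult.sign] at hp <;> rfl

lemma Mult.sign_mul_self (i : Mult n) : i.sign * i.sign = 1 := by
  rcases i with i | i <;> rfl

variable {a b : Fin (n + 1) → ℂˣ} {x y : ℂˣ}

lemma charge_eq (i : Mult n) (k : Fin n) :
    (sqcdChirals n a b x y).charge i k = i.sign * suWeight i.label k := by
  rcases i with i | i <;> simp [sqcdChirals, Mult.sign, Mult.label]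

lemma arg_inl (i j : Fin (n + 1)) (z : Fin n → ℂˣ) :
    (sqcdChirals n a b x y).arg (Sum.inl (i, j)) z = x * a i * suPoint z j := by
  simp only [ChiralData.arg, sqcdChirals, Sum.elim_inl, prod_zpow_suWeight, suPoint]

lemma arg_inr (i j : Fin (n + 1)) (z : Fin n → ℂˣ) :
    (sqcdChirals n a b x y).arg (Sum.inr (i, j)) z = y * b j * (suPoint z i)⁻¹ := by
  simp only [ChiralData.arg, sqcdChirals, Sum.elim_inr, Pi.neg_apply, zpow_neg,
    Finset.prod_inv_distrib, prod_zpow_suWeight, suPoint]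

lemma mem_active (i : Mult n) (z : Fin n → ℂˣ) :
    i ∈ (sqcdChirals n a b x y).active q z ↔
      ∃ m : ℤ, suPoint z i.label = q ^ m * i.pole a b x y := by
  simp only [ChiralData.active, Finset.mem_filter, Finset.mem_univ, true_and]
  rcases i with ⟨i, j⟩ | ⟨i, j⟩
  · simp only [arg_inl, Mult.label, Mult.pole, Sum.elim_inl]
    exact exists_congr fun m => by rw [eq_mul_inv_iff_mul_eq, mul_comm]
  · simp only [arg_inr, Mult.label, Mult.pole, Sum.elim_inr]
    constructor
    · rintro ⟨m, h⟩
      exact ⟨-m, by rw [zpow_neg, ← h]; group⟩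
    · rintro ⟨m, h⟩
      exact ⟨-m, by rw [h, zpow_neg, mul_inv, mul_left_comm, mul_inv_cancel, mul_one]⟩

/-! ### Points where `n` hypersurfaces meet -/

lemma card_active_le (hG : (sqcdChirals n a b x y).Generic q) (z : Fin n → ℂˣ) :
    ((sqcdChirals n a b x y).active q z).card ≤ n := by
  have h := (hG z).linearIndependent.fintype_card_le_finrank
  simpa using h

lemma eq_of_label_eq (hG : (sqcdChirals n a b x y).Generic q) {z : Fin n → ℂˣ} {i i' : Mult n}
    (hi : i ∈ (sqcdChirals n a b x y).active q z) (hi' : i' ∈ (sqcdChirals n a b x y).active q z)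
    (h : i.label = i'.label) : i = i' := by
  by_contra hne
  have h1 : LinearIndepOn ℝ (sqcdChirals n a b x y).realCharge {i, i'} :=
    (hG z).mono (by rintro _ (rfl | rfl) <;> assumption)
  rw [LinearIndepOn.pair_iff _ hne] at h1
  have h2 := h1 i.sign (-i'.sign) (by
    funext k
    simp only [Pi.add_apply, Pi.smul_apply, smul_eq_mul, ChiralData.realCharge, charge_eq, h,
      Pi.zero_apply]
    have e1 : (i.sign : ℝ) * i.sign = 1 := by exact_mod_cast i.sign_mul_self
    have e2 : (i'.sign : ℝ) * i'.sign = 1 := by exact_mod_cast i'.sign_mul_self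
    push_cast
    linear_combination (suWeight i'.label k : ℝ) * (e1 - e2))
  have e1 := i.sign_mul_self
  have h3 : i.sign = 0 := by exact_mod_cast h2.1
  simp [h3] at e1

/-- The point of the torus at which `ξ_j`, for `j ≠ j₀`, lies at the pole of a given multiplet. -/
def meetPoint (a b : Fin (n + 1) → ℂˣ) (x y : ℂˣ) (j₀ : Fin (n + 1)) (s : Fin n → Mult n) :
    Fin n → ℂˣ := fun k =>
  Fin.insertNth (α := fun _ => ℂˣ) j₀ (∏ k, (s k).pole a b x y)⁻¹ (fun k => (s k).pole a b x y)
    k.castSucc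

lemma suPoint_meetPoint (j₀ : Fin (n + 1)) (s : Fin n → Mult n) :
    suPoint (meetPoint a b x y j₀ s) = Fin.insertNth (α := fun _ => ℂˣ) j₀
      (∏ k, (s k).pole a b x y)⁻¹ (fun k => (s k).pole a b x y) := by
  apply suPoint_eq
  rw [Fin.prod_univ_succAbove _ j₀]
  simp

lemma injective_of_label {j₀ : Fin (n + 1)} {s : Fin n → Mult n}
    (hs : ∀ k, (s k).label = j₀.succAbove k) : Function.Injective s := fun k l h =>
  Fin.succAbove_right_injective (by rw [← hs, ← hs, h])

lemma active_eq_image (hG : (sqcdChirals n a b x y).Generic q) {j₀ : Fin (n + 1)}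
    {s : Fin n → Mult n} (hs : ∀ k, (s k).label = j₀.succAbove k) {z : Fin n → ℂˣ}
    (h : ∀ k, s k ∈ (sqcdChirals n a b x y).active q z) :
    (sqcdChirals n a b x y).active q z = Finset.univ.image s := by
  symm
  apply Finset.eq_of_subset_of_card_le
  · intro i hi
    obtain ⟨k, -, rfl⟩ := Finset.mem_image.1 hi
    exact h k
  · rw [Finset.card_image_of_injective _ (injective_of_label hs)]
    simpa using card_active_le hG z

lemma active_meetPoint (hG : (sqcdChirals n a b x y).Generic q) {j₀ : Fin (n + 1)}
    {s : Fin n → Mult n} (hs : ∀ k, (s k).label = j₀.succAbove k) :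
    (sqcdChirals n a b x y).active q (meetPoint a b x y j₀ s) = Finset.univ.image s := by
  refine active_eq_image hG hs fun k => (mem_active _ _).2 ⟨0, ?_⟩
  rw [hs, suPoint_meetPoint]
  simp

/-- No further hypersurface passes through a point at which `n` of them meet. -/
lemma inv_prod_pole_ne (hG : (sqcdChirals n a b x y).Generic q) {i : Mult n}
    {s : Fin n → Mult n} (hs : ∀ k, (s k).label = i.label.succAbove k) (m : ℤ) :
    (∏ k, (s k).pole a b x y)⁻¹ ≠ q ^ m * i.pole a b x y := by
  intro h
  have h1 : i ∈ (sqcdChirals n a b x y).active q (meetPoint a b x y i.label s) := by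
    rw [mem_active, suPoint_meetPoint]
    exact ⟨m, by simpa using h⟩
  rw [active_meetPoint hG hs] at h1
  obtain ⟨k, -, rfl⟩ := Finset.mem_image.1 h1
  exact Fin.succAbove_ne _ _ (hs k).symm

/-- Hypersurfaces of multiplets with the same label are disjoint. -/
lemma pole_ne (hn : 1 ≤ n) (hG : (sqcdChirals n a b x y).Generic q) {i i' : Mult n}
    (hne : i ≠ i') (h : i.label = i'.label) (m : ℤ) : i.pole a b x y ≠ q ^ m * i'.pole a b x y := by
  intro h1
  obtain ⟨k, hk⟩ : ∃ l : Fin (n + 1), l ≠ i.label := by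
    have : Nontrivial (Fin (n + 1)) := Fin.nontrivial_iff_two_le.2 (by omega)
    exact exists_ne _
  obtain ⟨k₀, hk₀⟩ := Fin.exists_succAbove_eq hk.symm
  set s : Fin n → Mult n := fun r => if r = k₀ then i else Mult.mk true 0 (k.succAbove r) with hs
  have hsl : ∀ r, (s r).label = k.succAbove r := by
    intro r
    by_cases hr : r = k₀
    · simp [hs, hr, hk₀]
    · simp [hs, hr]
  have h2 : i ∈ (sqcdChirals n a b x y).active q (meetPoint a b x y k s) := by
    rw [active_meetPoint hG hsl]
    exact Finset.mem_image.2 ⟨k₀, Finset.mem_univ _, by simp [hs]⟩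
  refine hne (eq_of_label_eq hG h2 ?_ h)
  obtain ⟨m', hm'⟩ := (mem_active _ _).1 h2
  exact (mem_active _ _).2 ⟨m' + m, by rw [← h, hm', h1, zpow_add, mul_assoc]⟩

/-- A point at which `n` hypersurfaces meet omits exactly one label. -/
lemma exists_section (hG : (sqcdChirals n a b x y).Generic q) {z : Fin n → ℂˣ}
    (hz : ((sqcdChirals n a b x y).active q z).card = n) :
    ∃ (j₀ : Fin (n + 1)) (s : Fin n → Mult n), (∀ k, (s k).label = j₀.succAbove k) ∧
      ∀ k, s k ∈ (sqcdChirals n a b x y).active q z := by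
  have h1 : (((sqcdChirals n a b x y).active q z).image Mult.label).card = n := by
    rw [Finset.card_image_of_injOn, hz]
    exact fun i hi i' hi' h => eq_of_label_eq hG hi hi' h
  have h2 : (((sqcdChirals n a b x y).active q z).image Mult.label)ᶜ.card = 1 := by
    rw [Finset.card_compl, h1]
    simp
  obtain ⟨j₀, hj₀⟩ := Finset.card_eq_one.1 h2
  have h3 : ∀ k : Fin n, ∃ i : Mult n, i ∈ (sqcdChirals n a b x y).active q z ∧
      i.label = j₀.succAbove k := by
    intro k
    have : j₀.succAbove k ∉ (((sqcdChirals n a b x y).active q z).image Mult.label)ᶜ := by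
      rw [hj₀, Finset.mem_singleton]
      exact Fin.succAbove_ne _ _
    rw [Finset.mem_compl, not_not, Finset.mem_image] at this
    exact this
  choose s hs hs' using h3
  exact ⟨j₀, s, hs', hs⟩

/-- The multiplets active at `z` determine `z` up to the lattice. -/
lemma exists_eq_meetPoint_mul {j₀ : Fin (n + 1)} {s : Fin n → Mult n}
    (hs : ∀ k, (s k).label = j₀.succAbove k) {z : Fin n → ℂˣ}
    (h : ∀ k, s k ∈ (sqcdChirals n a b x y).active q z) :
    ∃ l ∈ qLattice q n, z = meetPoint a b x y j₀ s * l := by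
  have h1 : ∀ k, ∃ m : ℤ, suPoint z (j₀.succAbove k) =
      q ^ m * suPoint (meetPoint a b x y j₀ s) (j₀.succAbove k) := by
    intro k
    have := (mem_active _ _).1 (h k)
    rw [hs] at this
    simpa [suPoint_meetPoint] using this
  choose m hm using h1
  have h2 : ∀ j, suPoint z j / suPoint (meetPoint a b x y j₀ s) j ∈ Subgroup.zpowers q := by
    have h3 : ∀ k, suPoint z (j₀.succAbove k) / suPoint (meetPoint a b x y j₀ s) (j₀.succAbove k)
        = q ^ m k := fun k => by rw [hm k, mul_div_cancel_right]
    intro j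
    rcases Fin.eq_self_or_eq_succAbove j₀ j with rfl | ⟨k, rfl⟩
    · have h4 : ∏ l, (suPoint z l / suPoint (meetPoint a b x y j s) l) = 1 := by
        rw [Finset.prod_div_distrib, prod_suPoint, prod_suPoint, div_one]
      rw [Fin.prod_univ_succAbove _ j] at h4
      rw [eq_inv_of_mul_eq_one_left h4]
      refine inv_mem (Subgroup.prod_mem _ fun k _ => ?_)
      rw [h3]
      exact Subgroup.zpow_mem_zpowers _ _
    · rw [h3]
      exact Subgroup.zpow_mem_zpowers _ _
  refine ⟨z / meetPoint a b x y j₀ s, ?_, (mul_div_cancel _ _).symm⟩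
  rw [qLattice, Subgroup.mem_pi]
  intro k _
  have := h2 k.castSucc
  rwa [suPoint_castSucc, suPoint_castSucc] at this

/-! ### Invariance of residues under the lattice -/

namespace ChiralData

variable {r : ℕ} {ι : Type}

lemma arg_mul (D : ChiralData r ι) (i : ι) (z l : Fin r → ℂˣ) :
    D.arg i (z * l) = D.arg i z * ∏ k, l k ^ D.charge i k := by
  simp only [arg, Pi.mul_apply, mul_zpow, Finset.prod_mul_distrib, mul_assoc]

lemma exists_prod_zpow_eq {l : Fin r → ℂˣ} (hl : l ∈ qLattice q r) (w : Fin r → ℤ) :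
    ∃ m : ℤ, ∏ k, l k ^ w k = q ^ m := by
  have h : ∏ k, l k ^ w k ∈ Subgroup.zpowers q := Subgroup.prod_mem _ fun k _ =>
    Subgroup.zpow_mem _ ((Subgroup.mem_pi _).1 hl k (Set.mem_univ _)) _
  obtain ⟨m, hm⟩ := Subgroup.mem_zpowers_iff.1 h
  exact ⟨m, hm.symm⟩

variable [Fintype ι]

lemma active_mul (D : ChiralData r ι) (z : Fin r → ℂˣ) {l : Fin r → ℂˣ}
    (hl : l ∈ qLattice q r) : D.active q (z * l) = D.active q z := by
  ext i
  simp only [active, Finset.mem_filter, Finset.mem_univ, true_and, arg_mul]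
  obtain ⟨m', hm'⟩ := exists_prod_zpow_eq hl (D.charge i)
  rw [hm']
  constructor
  · rintro ⟨m, h⟩
    exact ⟨m - m', by rw [zpow_sub, ← h, mul_inv_cancel_right]⟩
  · rintro ⟨m, h⟩
    exact ⟨m + m', by rw [h, zpow_add]⟩

lemma expPoint_mul (z l : Fin r → ℂˣ) (u : Fin r → ℂ) :
    expPoint (z * l) u = expPoint z u * l := by
  funext k
  simp only [expPoint, Pi.mul_apply, mul_right_comm]

lemma cleared_mul (D : ChiralData r ι) {f : (Fin r → ℂˣ) → ℂ}
    (hf : ∀ l ∈ qLattice q r, ∀ z, f (z * l) = f z) (z : Fin r → ℂˣ) {l : Fin r → ℂˣ}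
    (hl : l ∈ qLattice q r) : D.cleared q f (z * l) = D.cleared q f z := by
  funext u
  rw [cleared, cleared, expPoint_mul, hf l hl, active_mul D z hl]

lemma nearFilter_mul (D : ChiralData r ι) (z : Fin r → ℂˣ) {l : Fin r → ℂˣ}
    (hl : l ∈ qLattice q r) : D.nearFilter q (z * l) = D.nearFilter q z := by
  rw [nearFilter, nearFilter, active_mul D z hl]

lemma jkResidue_mul (D : ChiralData r ι) (η : Fin r → ℝ) {f : (Fin r → ℂˣ) → ℂ}
    (hf : ∀ l ∈ qLattice q r, ∀ z, f (z * l) = f z) (z : Fin r → ℂˣ) {l : Fin r → ℂˣ}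
    (hl : l ∈ qLattice q r) : D.jkResidue q η f (z * l) = D.jkResidue q η f z := by
  have h := active_mul D z hl
  rw [jkResidue, jkResidue, cleared_mul D hf z hl, nearFilter_mul D z hl]
  generalize D.active q (z * l) = S at h ⊢
  subst h
  rfl

lemma jkResidue_out (D : ChiralData r ι) (η : Fin r → ℝ) {f : (Fin r → ℂˣ) → ℂ}
    (hf : ∀ l ∈ qLattice q r, ∀ z, f (z * l) = f z) (z : Fin r → ℂˣ) :
    D.jkResidue q η f (QuotientGroup.mk (s := qLattice q r) z).out = D.jkResidue q η f z := by
  obtain ⟨l, hl⟩ := QuotientGroup.mk_out_eq_mul (qLattice q r) z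
  rw [hl]
  exact jkResidue_mul D η hf z l.2

lemma active_out (D : ChiralData r ι) (z : Fin r → ℂˣ) :
    D.active q (QuotientGroup.mk (s := qLattice q r) z).out = D.active q z := by
  obtain ⟨l, hl⟩ := QuotientGroup.mk_out_eq_mul (qLattice q r) z
  rw [hl]
  exact active_mul D z l.2

end ChiralData

/-! ### Charges, cones and regular parameters -/

/-- The charges of multiplets with `n` distinct labels form a basis of the weight lattice. -/
lemma natAbs_det_charge {j₀ : Fin (n + 1)} {s : Fin n → Mult n}
    (hs : ∀ k, (s k).label = j₀.succAbove k) {S : Finset (Mult n)} (hS : S = Finset.univ.image s)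
    (e : Fin n ≃ S) :
    (Matrix.of fun j k : Fin n => (sqcdChirals n a b x y).charge (e j : Mult n) k).det.natAbs =
      1 := by
  set M := Matrix.of fun j k : Fin n => (sqcdChirals n a b x y).charge (e j : Mult n) k with hM
  set v : Fin n → Fin (n + 1) → ℤ := fun k j => if j = k.castSucc then 1 else 0 with hv
  set L : Matrix (Fin n) (Fin n) ℤ := Matrix.of fun k j =>
    (e j : Mult n).sign * (v k (e j : Mult n).label - v k j₀) with hL
  have h : L * M = 1 := by
    ext k l
    have h1 : ∀ j, L k j * M j l =
        (v k (e j : Mult n).label - v k j₀) * suWeight (e j : Mult n).label l := by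
      intro j
      simp only [hL, hM, Matrix.of_apply, charge_eq]
      linear_combination ((v k (e j : Mult n).label - v k j₀) * suWeight (e j : Mult n).label l) *
        (e j : Mult n).sign_mul_self
    rw [Matrix.mul_apply]
    simp only [h1]
    rw [e.sum_comp (fun i : S => (v k (i : Mult n).label - v k j₀) *
      suWeight (i : Mult n).label l), Finset.sum_coe_sort S (fun i : Mult n =>
      (v k i.label - v k j₀) * suWeight i.label l), hS,
      Finset.sum_image fun i _ j _ h => injective_of_label hs h]
    simp only [hs]
    have h2 := sum_mul_suWeight (v k) (v k j₀) l
    rw [Fin.sum_univ_succAbove _ j₀, sub_self, zero_mul, zero_add] at h2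
    simp only [Int.cast_id] at h2
    rw [h2]
    simp [hv, Matrix.one_apply, (Fin.castSucc_lt_last k).ne', eq_comm]
  have hdet : L.det * M.det = 1 := by rw [← Matrix.det_mul, h, Matrix.det_one]
  exact Int.isUnit_iff_natAbs_eq.1 (IsUnit.of_mul_eq_one _ (by rw [mul_comm]; exact hdet))

/-- The parameter `η` as a function of all `n + 1` coordinates, the last one being `0`. -/
def extend (η : Fin n → ℝ) : Fin (n + 1) → ℝ := Fin.snoc η 0

lemma sum_extend_mul_suWeight (η : Fin n → ℝ) (c : ℝ) (k : Fin n) :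
    ∑ j, (extend η j - c) * (suWeight j k : ℝ) = η k := by
  rw [sum_mul_suWeight]
  simp [extend]

lemma realCharge_eq (i : Mult n) (k : Fin n) :
    (sqcdChirals n a b x y).realCharge i k = i.sign * suWeight i.label k := by
  rw [ChiralData.realCharge, charge_eq, Int.cast_mul]

lemma extend_sub_extend_of_eq_sum {S : Finset (Mult n)} {t : Mult n → ℝ} {η : Fin n → ℝ}
    (h : η = ∑ i ∈ S, t i • (sqcdChirals n a b x y).realCharge i) (j l : Fin (n + 1)) :
    extend η j - extend η l = ∑ i ∈ S, t i * i.sign *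
      ((if i.label = j then 1 else 0) - (if i.label = l then 1 else 0)) := by
  have key : ∀ j, extend η j = ∑ i ∈ S, t i * i.sign *
      ((if i.label = j then 1 else 0) - (if i.label = Fin.last n then 1 else 0)) := by
    intro j
    refine Fin.lastCases ?_ (fun k => ?_) j
    · simp [extend]
    · rw [extend, Fin.snoc_castSucc, h, Finset.sum_apply]
      refine Finset.sum_congr rfl fun i _ => ?_
      rw [Pi.smul_apply, realCharge_eq, suWeight_eq, smul_eq_mul]
      push_cast
      ring
  rw [key j, key l, ← Finset.sum_sub_distrib]
  refine Finset.sum_congr rfl fun i _ => ?_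
  ring

/-- The coefficients of `η` in the basis of the charges of multiplets with all labels but `j₀` are
the signed differences `η_j - η_{j₀}`. -/
lemma mem_openCone_iff {j₀ : Fin (n + 1)} {s : Fin n → Mult n}
    (hs : ∀ k, (s k).label = j₀.succAbove k) (η : Fin n → ℝ) :
    η ∈ (sqcdChirals n a b x y).openCone (Finset.univ.image s) ↔
      ∀ k, 0 < ((s k).sign : ℝ) * (extend η (j₀.succAbove k) - extend η j₀) := by
  have hinj := injective_of_label hs
  have hsum : ∀ F : Mult n → ℝ, ∑ i ∈ Finset.univ.image s, F i = ∑ k, F (s k) := fun F =>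
    Finset.sum_image fun i _ j _ h => hinj h
  have hsq : ∀ i : Mult n, (i.sign : ℝ) * i.sign = 1 := fun i => by exact_mod_cast i.sign_mul_self
  constructor
  · rintro ⟨t, ht, h⟩ k
    rw [extend_sub_extend_of_eq_sum h, hsum]
    simp only [hs, Fin.succAbove_right_inj, Fin.succAbove_ne, if_false, sub_zero, mul_ite, mul_one,
      mul_zero, Finset.sum_ite_eq', Finset.mem_univ, if_true]
    rw [mul_left_comm, hsq, mul_one]
    exact ht _ (Finset.mem_image_of_mem _ (Finset.mem_univ _))
  · intro h
    refine ⟨fun i : Mult n => i.sign * (extend η i.label - extend η j₀), fun i hi => ?_, ?_⟩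
    · obtain ⟨k, -, rfl⟩ := Finset.mem_image.1 hi
      simp only [hs]
      exact h k
    · funext k
      rw [Finset.sum_apply, hsum, ← sum_extend_mul_suWeight η (extend η j₀) k,
        Fin.sum_univ_succAbove _ j₀, sub_self, zero_mul, zero_add]
      refine Finset.sum_congr rfl fun r _ => ?_
      simp only [Pi.smul_apply, smul_eq_mul, realCharge_eq, hs]
      linear_combination (-(extend η (j₀.succAbove r) - extend η j₀) *
        (suWeight (j₀.succAbove r) k : ℝ)) * hsq (s r)

/-- If `η_j = η_l`, then, as the weights sum to zero, `η` is a combination of the `n - 1` other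
weights. -/
lemma extend_injective {η : Fin n → ℝ} (h : (sqcdChirals n a b x y).IsRegular η) :
    Function.Injective (extend η) := by
  intro j l hjl
  by_contra hne
  set T : Finset (Fin (n + 1)) := (Finset.univ.erase j).erase l with hT
  set g : Fin (n + 1) → Mult n := fun k => Mult.mk (decide (extend η j < extend η k)) 0 k with hg
  have hginj : Function.Injective g := fun k k' h => by
    have := congrArg Mult.label h
    simpa [hg] using this
  have hcard : T.card + 1 = n := by
    rw [hT, Finset.card_erase_add_one, Finset.card_erase_of_mem (Finset.mem_univ _)]
    · simp
    · simp [Ne.symm hne]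
  refine h (T.image g) ?_
    ⟨fun i : Mult n => |extend η i.label - extend η j|, fun i _ => abs_nonneg _, ?_⟩
  · rw [Finset.card_image_of_injective _ hginj]
    omega
  · funext k
    rw [Finset.sum_apply, Finset.sum_image fun i _ j _ h => hginj h,
      ← sum_extend_mul_suWeight η (extend η j) k]
    symm
    refine Finset.sum_congr_of_eq_on_inter ?_ ?_ ?_
    · simp
    · intro r _ hr
      have : r = j ∨ r = l := by
        by_contra! hc
        exact hr (by simp [hT, hc.1, hc.2])
      rcases this with rfl | rfl <;> simp [hjl]
    · intro r _ _
      rw [Pi.smul_apply, smul_eq_mul, realCharge_eq]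
      simp only [hg, Mult.label_mk, Mult.sign_mk, decide_eq_true_eq]
      split_ifs with hlt
      · rw [abs_of_pos (sub_pos.2 hlt)]
        simp
      · rw [abs_of_nonpos (sub_nonpos.2 (not_lt.1 hlt))]
        push_cast
        ring

/-! ### The points that contribute for a given parameter -/

/-- For a parameter `η`, the multiplets whose hypersurfaces meet at a contributing point that omits
the label `j₀`: the sign for the label `j` is that of `η_j - η_{j₀}`, the flavors are free. -/
noncomputable def coneSection (η : Fin n → ℝ) (j₀ : Fin (n + 1)) (i : Fin n → Fin (n + 1))
    (k : Fin n) : Mult n :=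
  Mult.mk (decide (extend η j₀ < extend η (j₀.succAbove k))) (i k) (j₀.succAbove k)

lemma label_coneSection (η : Fin n → ℝ) (j₀ : Fin (n + 1)) (i : Fin n → Fin (n + 1)) (k : Fin n) :
    (coneSection η j₀ i k).label = j₀.succAbove k := Mult.label_mk _ _ _

lemma mem_openCone_coneSection {η : Fin n → ℝ} (hη : Function.Injective (extend η))
    (j₀ : Fin (n + 1)) (i : Fin n → Fin (n + 1)) :
    η ∈ (sqcdChirals n a b x y).openCone (Finset.univ.image (coneSection η j₀ i)) := by
  rw [mem_openCone_iff (label_coneSection η j₀ i)]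
  intro k
  simp only [coneSection, Mult.sign_mk, decide_eq_true_eq]
  have hne : extend η j₀ ≠ extend η (j₀.succAbove k) := fun h => Fin.succAbove_ne j₀ k (hη h).symm
  split_ifs with h
  · simpa using h
  · have := lt_of_le_of_ne (not_lt.1 h) hne.symm
    simpa using this

lemma eq_coneSection {η : Fin n → ℝ} {j₀ : Fin (n + 1)} {s : Fin n → Mult n}
    (hs : ∀ k, (s k).label = j₀.succAbove k)
    (h : η ∈ (sqcdChirals n a b x y).openCone (Finset.univ.image s)) :
    s = coneSection η j₀ fun k => (s k).flavor := by
  rw [mem_openCone_iff hs] at h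
  funext k
  rw [coneSection, ← hs, Mult.mk_eta]
  have hk := h k
  rw [← hs] at hk
  rw [decide_eq_true_eq]
  generalize s k = i at hk
  rcases i with i | i
  · simpa [Mult.sign] using hk
  · simp only [Mult.sign, Sum.elim_inr, Int.reduceNeg, Int.cast_neg, Int.cast_one, neg_mul, one_mul,
      Left.neg_pos_iff, sub_neg] at hk ⊢
    simpa using hk.le

/-- The Jeffrey–Kirwan integral as a sum over the omitted label and the flavors. -/
lemma jkIntegral_eq_sum (hG : (sqcdChirals n a b x y).Generic q) {f : (Fin n → ℂˣ) → ℂ}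
    (hf : ∀ l ∈ qLattice q n, ∀ z, f (z * l) = f z) {η : Fin n → ℝ}
    (hη : Function.Injective (extend η)) :
    (sqcdChirals n a b x y).jkIntegral q η f = ∑ j₀, ∑ i : Fin n → Fin (n + 1),
      limUnder ((sqcdChirals n a b x y).nearFilter q (meetPoint a b x y j₀ (coneSection η j₀ i)))
        ((sqcdChirals n a b x y).cleared q f (meetPoint a b x y j₀ (coneSection η j₀ i))) := by
  classical
  set D := sqcdChirals n a b x y with hD
  set Φ : Fin (n + 1) × (Fin n → Fin (n + 1)) → (Fin n → ℂˣ) ⧸ qLattice q n := fun p =>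
    QuotientGroup.mk (meetPoint a b x y p.1 (coneSection η p.1 p.2)) with hΦ
  have hact : ∀ p, D.active q (Φ p).out = Finset.univ.image (coneSection η p.1 p.2) := fun p => by
    rw [hΦ, ChiralData.active_out, active_meetPoint hG (label_coneSection η p.1 p.2)]
  have hinj : Function.Injective Φ := by
    rintro ⟨j, i⟩ ⟨j', i'⟩ h
    have h1 : Finset.univ.image (coneSection η j i) = Finset.univ.image (coneSection η j' i') := by
      rw [← hact (j, i), ← hact (j', i'), h]
    have h2 : ∀ k, ∃ k', coneSection η j' i' k' = coneSection η j i k := fun k => by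
      have : coneSection η j i k ∈ Finset.univ.image (coneSection η j' i') := by
        rw [← h1]
        exact Finset.mem_image_of_mem _ (Finset.mem_univ _)
      simpa using this
    have h3 : j' = j := by
      by_contra hne
      obtain ⟨k, hk⟩ := Fin.exists_succAbove_eq hne
      obtain ⟨k', hk'⟩ := h2 k
      have := congrArg Mult.label hk'
      rw [label_coneSection, label_coneSection, hk] at this
      exact Fin.succAbove_ne _ _ this
    subst h3
    congr 1
    funext k
    obtain ⟨k', hk'⟩ := h2 k
    have h4 := congrArg Mult.label hk'
    rw [label_coneSection, label_coneSection] at h4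
    have h5 := Fin.succAbove_right_injective h4
    subst h5
    have := congrArg Mult.flavor hk'
    simpa [coneSection] using this.symm
  have hsupp : Function.support (fun p : (Fin n → ℂˣ) ⧸ qLattice q n => D.jkResidue q η f p.out) ⊆
      ((Finset.univ.image Φ : Finset _) : Set _) := by
    intro p hp
    rw [Function.mem_support, ChiralData.jkResidue] at hp
    split_ifs at hp with hc hcone
    · obtain ⟨j₀, s, hs, hs'⟩ := exists_section hG hc
      obtain ⟨l, hl, hpl⟩ := exists_eq_meetPoint_mul hs hs'
      rw [active_eq_image hG hs hs'] at hcone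
      rw [Finset.mem_coe, Finset.mem_image]
      refine ⟨(j₀, fun k => (s k).flavor), Finset.mem_univ _, ?_⟩
      rw [hΦ]
      simp only
      rw [← eq_coneSection hs hcone, ← QuotientGroup.out_eq' p, hpl, QuotientGroup.mk_mul,
        (QuotientGroup.eq_one_iff l).2 hl]
      exact (mul_one (QuotientGroup.mk (s := qLattice q n) (meetPoint a b x y j₀ s))).symm
    all_goals exact absurd rfl hp
  rw [ChiralData.jkIntegral, finsum_eq_sum_of_support_subset _ hsupp,
    Finset.sum_image fun p _ p' _ h => hinj h, Fintype.sum_prod_type]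
  refine Finset.sum_congr rfl fun j₀ _ => Finset.sum_congr rfl fun i _ => ?_
  rw [hΦ]
  simp only
  rw [ChiralData.jkResidue_out D η hf]
  have hl := label_coneSection η j₀ i
  have hA := active_meetPoint hG hl
  have hcard : (D.active q (meetPoint a b x y j₀ (coneSection η j₀ i))).card = n := by
    rw [hA, Finset.card_image_of_injective _ (injective_of_label hl)]
    simp
  rw [ChiralData.jkResidue, dif_pos hcard, if_pos, natAbs_det_charge hl hA]
  · simp
  · rw [hA]
    exact mem_openCone_coneSection hη j₀ i

/-- The active multiplets determine a point at which `n` hypersurfaces meet, up to the lattice, and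
there are finitely many sets of multiplets. -/
lemma finite_card_active_eq (hG : (sqcdChirals n a b x y).Generic q) :
    {p : (Fin n → ℂˣ) ⧸ qLattice q n |
      ((sqcdChirals n a b x y).active q p.out).card = n}.Finite := by
  refine Set.Finite.of_finite_image (f := fun p => (sqcdChirals n a b x y).active q p.out)
    (Set.toFinite _) fun p hp p' hp' h => ?_
  obtain ⟨j₀, s, hs, hs'⟩ := exists_section hG hp
  obtain ⟨l, hl, hpl⟩ := exists_eq_meetPoint_mul hs hs'
  simp only at h
  rw [h] at hs'
  obtain ⟨l', hl', hpl'⟩ := exists_eq_meetPoint_mul hs hs'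
  rw [← QuotientGroup.out_eq' p, ← QuotientGroup.out_eq' p', hpl, hpl', QuotientGroup.mk_mul,
    QuotientGroup.mk_mul, (QuotientGroup.eq_one_iff l).2 hl, (QuotientGroup.eq_one_iff l').2 hl']

/-! ### Local behaviour of Kronecker's function -/

/-- The unit `e^{-v}`. -/
noncomputable def expNeg (v : ℂ) : ℂˣ := Units.mk0 (Complex.exp (-v)) (Complex.exp_ne_zero _)

@[simp] lemma expNeg_zero : expNeg 0 = 1 := by ext; simp [expNeg]

lemma expNeg_neg (v : ℂ) : expNeg (-v) = (expNeg v)⁻¹ := by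
  ext; simp [expNeg, Complex.exp_neg]

lemma continuous_expNeg : Continuous expNeg := continuous_mk0_exp continuous_neg

lemma prod_expNeg_zpow (u : Fin n → ℂ) (w : Fin n → ℤ) :
    ∏ k, expNeg (u k) ^ w k = expNeg (∑ k, (w k : ℂ) * u k) := by
  ext
  simp only [expNeg, Units.coe_prod, Units.val_zpow_eq_zpow_val, Units.val_mk0,
    ← Complex.exp_int_mul, ← Complex.exp_sum]
  congr 1
  rw [← Finset.sum_neg_distrib]
  exact Finset.sum_congr rfl fun k _ => by ring

lemma tendsto_div_theta (hq : ‖(q : ℂ)‖ < 1) :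
    Tendsto (fun v : ℂ => v / theta q (expNeg v)) (𝓝[≠] 0) (𝓝 (qPoch q q ^ 2)⁻¹) := by
  have hφ := qPoch_self_ne_zero hq
  have hd : HasDerivAt (fun v : ℂ => -Complex.exp (-v)) 1 0 := by
    have := ((hasDerivAt_neg (0 : ℂ)).cexp).fun_neg
    simpa using this
  have h1 : Tendsto (fun v : ℂ => v⁻¹ * (1 - Complex.exp (-v))) (𝓝[≠] 0) (𝓝 1) := by
    have := hasDerivAt_iff_tendsto_slope.1 hd
    refine this.congr fun v => ?_
    rw [slope_def_field]
    simp
    ring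
  have h2 : Tendsto (fun v : ℂ => qPoch q (q * (expNeg v : ℂˣ)) *
      qPoch q ((q / expNeg v : ℂˣ) : ℂ)) (𝓝[≠] 0) (𝓝 (qPoch q q ^ 2)) := by
    have hc : Continuous fun v : ℂ => qPoch q (q * (expNeg v : ℂˣ)) *
        qPoch q ((q / expNeg v : ℂˣ) : ℂ) := by
      have := continuous_expNeg
      refine ((continuous_qPoch hq).comp (continuous_const.mul (Units.continuous_val.comp this))).mul
        ((continuous_qPoch hq).comp (Units.continuous_val.comp ?_))
      exact continuous_const.div' this
    have := (hc.tendsto 0).mono_left (nhdsWithin_le_nhds (s := {0}ᶜ))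
    simpa [sq] using this
  have h3 := (h1.mul h2).inv₀ (by simpa using hφ)
  rw [one_mul] at h3
  refine h3.congr fun v => ?_
  rw [theta_eq hq]
  simp only [expNeg, Units.val_mk0, mul_inv, inv_inv, div_eq_mul_inv]
  ring

lemma eventually_theta_expNeg_ne_zero (hq : ‖(q : ℂ)‖ < 1) :
    ∀ᶠ v in 𝓝[≠] (0 : ℂ), theta q (expNeg v) ≠ 0 := by
  have h := (tendsto_div_theta hq).eventually_ne
    (inv_ne_zero (pow_ne_zero 2 (qPoch_self_ne_zero hq)))
  filter_upwards [h] with v hv h0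
  exact hv (by rw [h0, div_zero])

lemma tendsto_kron_expNeg (hq : ‖(q : ℂ)‖ < 1) {t : ℂˣ} (ht : theta q t ≠ 0) :
    Tendsto (fun v : ℂ => kron q t (expNeg v) * v) (𝓝[≠] 0) (𝓝 (qPoch q q ^ 2)⁻¹) := by
  have h1 : Tendsto (fun v : ℂ => theta q (t * expNeg v) / theta q t) (𝓝[≠] 0) (𝓝 1) := by
    have hc : Continuous fun v : ℂ => theta q (t * expNeg v) / theta q t :=
      ((continuous_theta hq).comp (continuous_const.mul continuous_expNeg)).div_const _
    have := (hc.tendsto 0).mono_left (nhdsWithin_le_nhds (s := {0}ᶜ))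
    simpa [ht] using this
  have h2 := h1.mul (tendsto_div_theta hq)
  rw [one_mul] at h2
  refine h2.congr fun v => ?_
  rw [kron]
  field_simp

lemma tendsto_kron_inv_expNeg (hq : ‖(q : ℂ)‖ < 1) {t : ℂˣ} (ht : theta q t ≠ 0) :
    Tendsto (fun v : ℂ => kron q t (expNeg v)⁻¹ * -v) (𝓝[≠] 0) (𝓝 (qPoch q q ^ 2)⁻¹) := by
  have h : Tendsto (fun v : ℂ => -v) (𝓝[≠] 0) (𝓝[≠] 0) := by
    refine tendsto_nhdsWithin_iff.2 ⟨?_, ?_⟩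
    · have := (continuous_neg.tendsto (0 : ℂ)).mono_left (nhdsWithin_le_nhds (s := {0}ᶜ))
      simpa using this
    · filter_upwards [self_mem_nhdsWithin] with v hv
      simpa using hv
  refine ((tendsto_kron_expNeg hq ht).comp h).congr fun v => ?_
  simp [expNeg_neg]

lemma continuousAt_kron (hq : ‖(q : ℂ)‖ < 1) {t z : ℂˣ} (ht : theta q t ≠ 0)
    (hz : theta q z ≠ 0) : ContinuousAt (kron q t) z := by
  have h := continuous_theta hq
  exact ((h.comp (continuous_const.mul continuous_id)).continuousAt).div
    (continuousAt_const.mul h.continuousAt) (mul_ne_zero ht hz)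

/-! ### The integrand as a product of two determinants -/

/-- The product `K_t(α ξ) K_s(β / ξ)` of Kronecker functions, with poles at `1 / α` and `β`. -/
noncomputable def kronPair (q t s α β ξ : ℂˣ) : ℂ := kron q t (α * ξ) * kron q s (β * ξ⁻¹)

/-- The auxiliary parameters `t`, `s` of the Kronecker functions avoid the zeros of the theta
functions of `t`, `s`, `t / s`, `t X` and `s Y`. -/
structure GoodParams (q X Y t s : ℂˣ) : Prop where
  ht : theta q t ≠ 0
  hs : theta q s ≠ 0
  hts : theta q (t / s) ≠ 0
  htX : theta q (t * X) ≠ 0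
  hsY : theta q (s * Y) ≠ 0

lemma exists_goodParams (hq : ‖(q : ℂ)‖ < 1) (X Y : ℂˣ) : ∃ t s : ℂˣ, GoodParams q X Y t s := by
  have key : ∀ c d : ℂˣ, ∃ t : ℂˣ, theta q t ≠ 0 ∧ theta q (t * c) ≠ 0 ∧ theta q (t * d) ≠ 0 := by
    intro c d
    have h := (((countable_theta_expRay hq 1).union (countable_theta_expRay hq c)).union
      (countable_theta_expRay hq d)).dense_compl ℝ
    obtain ⟨u, hu⟩ := h.nonempty
    simp only [Set.mem_compl_iff, Set.mem_union, Set.mem_ofPred_eq, not_or] at hu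
    refine ⟨expRay 1 u, hu.1.1, ?_, ?_⟩
    · have := hu.1.2
      rwa [expRay, mul_comm, ← one_mul (Units.mk0 _ _)] at this
    · have := hu.2
      rwa [expRay, mul_comm, ← one_mul (Units.mk0 _ _)] at this
  obtain ⟨t, ht, htX, -⟩ := key X 1
  obtain ⟨s, hs, hsY, hst⟩ := key Y t⁻¹
  refine ⟨t, s, ht, hs, ?_, htX, hsY⟩
  have := theta_inv hq (s * t⁻¹)
  rw [mul_inv, inv_inv, mul_comm, ← div_eq_mul_inv] at this
  rw [this]
  exact mul_ne_zero (neg_ne_zero.2 (inv_ne_zero (Units.ne_zero _))) hst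

/-- The constant that relates the integrand to the product of two Frobenius determinants. -/
noncomputable def sqcdConst (q : ℂˣ) (a b : Fin (n + 1) → ℂˣ) (x y t s : ℂˣ) : ℂ :=
  qPoch q q ^ (2 * n) * (theta q t / theta q (t * x ^ (n + 1)) *
    (theta q s / theta q (s * y ^ (n + 1)))) /
    (ellVandermonde q (fun i => x * a i) * ellVandermonde q (fun i => y * b i))

/-- The term of the expansion of the two determinants that belongs to two permutations. -/
noncomputable def sqcdTerm (q : ℂˣ) (a b : Fin (n + 1) → ℂˣ) (x y t s : ℂˣ)
    (σ τ : Equiv.Perm (Fin (n + 1))) (z : Fin n → ℂˣ) : ℂ :=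
  ∏ j, kronPair q t s (x * a (σ j)) (y * b (τ j)) (suPoint z j)

lemma ellVandermonde_mul_ne_zero {c : ℂˣ} {a : Fin (n + 1) → ℂˣ}
    (h : ∀ i j, i ≠ j → theta q (a i / a j) ≠ 0) :
    ellVandermonde q (fun i => c * a i) ≠ 0 :=
  ellVandermonde_ne_zero fun i j hij => by simpa using h i j hij

lemma prod_const_mul {c : ℂˣ} {a : Fin (n + 1) → ℂˣ} (ha : ∏ i, a i = 1) :
    ∏ i, (c * a i) = c ^ (n + 1) := by
  simp [Finset.prod_mul_distrib, ha]

/-- Away from the singular hypersurfaces, the integrand is a linear combination of products of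
functions of a single coordinate. -/
lemma sqcdIntegrand_eq (hq : ‖(q : ℂ)‖ < 1) (ha : ∏ i, a i = 1) (hb : ∏ i, b i = 1)
    (haa : ∀ i j, i ≠ j → theta q (a i / a j) ≠ 0) (hbb : ∀ i j, i ≠ j → theta q (b i / b j) ≠ 0)
    {t s : ℂˣ} (hp : GoodParams q (x ^ (n + 1)) (y ^ (n + 1)) t s) {z : Fin n → ℂˣ}
    (hz : ∀ i, theta q ((sqcdChirals n a b x y).arg i z) ≠ 0) :
    sqcdIntegrand q n a b x y z = sqcdConst q a b x y t s *
      ∑ σ : Equiv.Perm (Fin (n + 1)), ∑ τ : Equiv.Perm (Fin (n + 1)),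
        (((Equiv.Perm.sign σ : ℤ) : ℂ) * ((Equiv.Perm.sign τ : ℤ) : ℂ)) *
          sqcdTerm q a b x y t s σ τ z := by
  have h1 : ∀ i j, theta q (x * a i * suPoint z j) ≠ 0 := fun i j => by
    rw [← arg_inl (b := b) (y := y)]; exact hz _
  have h2 : ∀ i j, theta q (y * b i * (suPoint z)⁻¹ j) ≠ 0 := fun i j => by
    rw [Pi.inv_apply, ← arg_inr (a := a) (x := x)]; exact hz _
  have d1 := det_kron hq (fun i => x * a i) (suPoint z) h1 hp.ht
  have d2 := det_kron hq (fun i => y * b i) (suPoint z)⁻¹ h2 hp.hs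
  rw [prod_const_mul ha, prod_suPoint, mul_one] at d1
  simp only [Pi.inv_apply, Finset.prod_inv_distrib] at d2
  rw [prod_const_mul hb, prod_suPoint, inv_one, mul_one] at d2
  have n1 := ellVandermonde_mul_ne_zero (c := x) haa
  have n2 := ellVandermonde_mul_ne_zero (c := y) hbb
  have n3 : ∏ i, ∏ j, theta q (x * a i * suPoint z j) ≠ 0 :=
    Finset.prod_ne_zero_iff.2 fun _ _ => Finset.prod_ne_zero_iff.2 fun _ _ => h1 _ _
  have n4 : ∏ i, ∏ j, theta q (y * b i * (suPoint z j)⁻¹) ≠ 0 :=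
    Finset.prod_ne_zero_iff.2 fun _ _ => Finset.prod_ne_zero_iff.2 fun _ _ => h2 _ _
  have e : ∑ σ : Equiv.Perm (Fin (n + 1)), ∑ τ : Equiv.Perm (Fin (n + 1)),
        (((Equiv.Perm.sign σ : ℤ) : ℂ) * ((Equiv.Perm.sign τ : ℤ) : ℂ)) *
          sqcdTerm q a b x y t s σ τ z =
      (Matrix.of fun i j => kron q t (x * a i * suPoint z j)).det *
        (Matrix.of fun i j => kron q s (y * b i * (suPoint z j)⁻¹)).det := by
    rw [Matrix.det_apply', Matrix.det_apply', Finset.sum_mul_sum]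
    refine Finset.sum_congr rfl fun σ _ => Finset.sum_congr rfl fun τ _ => ?_
    simp only [sqcdTerm, kronPair, Finset.prod_mul_distrib, Matrix.of_apply]
    ring
  have e2 : indexU q (suPoint z)⁻¹ b y = (∏ i, ∏ j, theta q (y * b i * (suPoint z j)⁻¹))⁻¹ := by
    rw [indexU, Finset.prod_comm]
    simp only [one_div, Finset.prod_inv_distrib, Pi.inv_apply, mul_right_comm]
  have e1 : indexU q a (suPoint z) x = (∏ i, ∏ j, theta q (x * a i * suPoint z j))⁻¹ := by
    rw [indexU]
    simp only [one_div, Finset.prod_inv_distrib]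
  rw [e, d1, d2, sqcdIntegrand, e1, e2, indexV, prod_roots_eq, sqcdConst]
  have := hp.ht
  have := hp.hs
  have := hp.htX
  have := hp.hsY
  field_simp

/-! ### Consequences of genericity -/

lemma theta_mul_ne_zero_of_generic (hq : ‖(q : ℂ)‖ < 1) (hn : 1 ≤ n)
    (hG : (sqcdChirals n a b x y).Generic q) (i j : Fin (n + 1)) :
    theta q (x * a i * (y * b j)) ≠ 0 := by
  rw [Ne, theta_eq_zero_iff hq]
  rintro ⟨m, h⟩
  refine pole_ne hn hG (i := Sum.inr (0, j)) (i' := Sum.inl (i, 0)) (by simp) rfl m ?_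
  simp only [Mult.pole, Sum.elim_inl, Sum.elim_inr]
  rw [eq_mul_inv_iff_mul_eq, mul_comm, h]

lemma theta_div_ne_zero_of_generic_left (hq : ‖(q : ℂ)‖ < 1) (hn : 1 ≤ n)
    (hG : (sqcdChirals n a b x y).Generic q) {i j : Fin (n + 1)} (hij : i ≠ j) :
    theta q (a i / a j) ≠ 0 := by
  rw [Ne, theta_eq_zero_iff hq]
  rintro ⟨m, h⟩
  refine pole_ne hn hG (i := Sum.inl (j, 0)) (i' := Sum.inl (i, 0))
    (by simpa using hij.symm) rfl m ?_
  simp only [Mult.pole, Sum.elim_inl]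
  rw [← h, mul_inv, mul_inv]
  ext
  push_cast
  field_simp

lemma theta_div_ne_zero_of_generic_right (hq : ‖(q : ℂ)‖ < 1) (hn : 1 ≤ n)
    (hG : (sqcdChirals n a b x y).Generic q) {i j : Fin (n + 1)} (hij : i ≠ j) :
    theta q (b i / b j) ≠ 0 := by
  rw [Ne, theta_eq_zero_iff hq]
  rintro ⟨m, h⟩
  refine pole_ne hn hG (i := Sum.inr (0, i)) (i' := Sum.inr (0, j)) (by simpa using hij) rfl m ?_
  simp only [Mult.pole, Sum.elim_inr]
  rw [← h]
  ext
  push_cast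
  field_simp

lemma theta_pow_ne_zero_of_generic_left (hq : ‖(q : ℂ)‖ < 1)
    (ha : ∏ i, a i = 1) (hG : (sqcdChirals n a b x y).Generic q) :
    theta q (x ^ (n + 1)) ≠ 0 := by
  rw [Ne, theta_eq_zero_iff hq]
  rintro ⟨m, h⟩
  refine inv_prod_pole_ne hG (i := Sum.inl (Fin.last n, Fin.last n))
    (s := fun k => Sum.inl ((Fin.last n).succAbove k, (Fin.last n).succAbove k)) (fun k => rfl) m ?_
  rw [← prod_const_mul ha, Fin.prod_univ_succAbove _ (Fin.last n)] at h
  simp only [Mult.pole, Sum.elim_inl, Finset.prod_inv_distrib, inv_inv]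
  rw [← h, mul_right_comm, mul_inv_cancel, one_mul]

lemma theta_pow_ne_zero_of_generic_right (hq : ‖(q : ℂ)‖ < 1)
    (hb : ∏ i, b i = 1) (hG : (sqcdChirals n a b x y).Generic q) :
    theta q (y ^ (n + 1)) ≠ 0 := by
  rw [Ne, theta_eq_zero_iff hq]
  rintro ⟨m, h⟩
  refine inv_prod_pole_ne hG (i := Sum.inr (Fin.last n, Fin.last n))
    (s := fun k => Sum.inr ((Fin.last n).succAbove k, (Fin.last n).succAbove k)) (fun k => rfl)
    (-m) ?_
  rw [← prod_const_mul hb, Fin.prod_univ_succAbove _ (Fin.last n)] at h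
  simp only [Mult.pole, Sum.elim_inr]
  rw [zpow_neg, ← h, mul_inv, mul_right_comm, inv_mul_cancel, one_mul]

lemma theta_arg_ne_zero_iff (hq : ‖(q : ℂ)‖ < 1) (i : Mult n) (z : Fin n → ℂˣ) :
    theta q ((sqcdChirals n a b x y).arg i z) ≠ 0 ↔
      i ∉ (sqcdChirals n a b x y).active q z := by
  rw [Ne, theta_eq_zero_iff hq]
  simp [ChiralData.active]

/-! ### Ellipticity -/

lemma sqcdIntegrand_eq_zero_of_active (hq : ‖(q : ℂ)‖ < 1) {i : Mult n} {z : Fin n → ℂˣ}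
    (h : i ∈ (sqcdChirals n a b x y).active q z) : sqcdIntegrand q n a b x y z = 0 := by
  have h0 : theta q ((sqcdChirals n a b x y).arg i z) = 0 := by
    by_contra h1
    exact (theta_arg_ne_zero_iff hq i z).1 h1 h
  rcases i with ⟨i, j⟩ | ⟨i, j⟩
  · rw [arg_inl] at h0
    have : indexU q a (suPoint z) x = 0 :=
      Finset.prod_eq_zero (Finset.mem_univ i) (Finset.prod_eq_zero (Finset.mem_univ j)
        (by rw [h0, div_zero]))
    rw [sqcdIntegrand, this, zero_mul, zero_mul]
  · rw [arg_inr, mul_right_comm] at h0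
    have : indexU q (suPoint z)⁻¹ b y = 0 :=
      Finset.prod_eq_zero (Finset.mem_univ i) (Finset.prod_eq_zero (Finset.mem_univ j)
        (by rw [Pi.inv_apply, h0, div_zero]))
    rw [sqcdIntegrand, this, mul_zero]

lemma suPoint_mul (z l : Fin n → ℂˣ) (j : Fin (n + 1)) :
    suPoint (z * l) j = suPoint z j * suPoint l j := by
  rw [suPoint, suPoint, suPoint, ← prod_zpow_suWeight, ← prod_zpow_suWeight, ← prod_zpow_suWeight]
  simp only [Pi.mul_apply, mul_zpow, Finset.prod_mul_distrib]

lemma prod_zpow_eq_zpow_sum {G ι : Type*} [CommGroup G] (S : Finset ι) (c : G) (m : ι → ℤ) :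
    ∏ j ∈ S, c ^ m j = c ^ ∑ j ∈ S, m j := by
  induction S using Finset.cons_induction with
  | empty => simp
  | cons j S hj ih => rw [Finset.prod_cons, Finset.sum_cons, zpow_add, ih]

/-- Each term is elliptic, because the multipliers of the factors cancel on `ξ_1 ⋯ ξ_{n+1} = 1`. -/
lemma sqcdTerm_mul (hq : ‖(q : ℂ)‖ < 1) (t s : ℂˣ) (σ τ : Equiv.Perm (Fin (n + 1)))
    (z : Fin n → ℂˣ) {l : Fin n → ℂˣ} (hl : l ∈ qLattice q n) :
    sqcdTerm q a b x y t s σ τ (z * l) = sqcdTerm q a b x y t s σ τ z := by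
  have h1 : ∀ k, ∃ m : ℤ, l k = q ^ m := fun k => by
    obtain ⟨m, hm⟩ := Subgroup.mem_zpowers_iff.1 ((Subgroup.mem_pi _).1 hl k (Set.mem_univ _))
    exact ⟨m, hm.symm⟩
  choose m hm using h1
  set M : Fin (n + 1) → ℤ := Fin.snoc m (-∑ k, m k) with hM
  have hMl : ∀ j, suPoint l j = q ^ M j := by
    intro j
    refine Fin.lastCases ?_ (fun k => ?_) j
    · simp [suPoint, hM, hm, prod_zpow_eq_zpow_sum]
    · simp [suPoint, hM, hm]
  have hM0 : ∑ j, M j = 0 := by rw [Fin.sum_univ_castSucc]; simp [hM]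
  have hpair : ∀ j, kronPair q t s (x * a (σ j)) (y * b (τ j)) (suPoint (z * l) j) =
      ((s / t : ℂˣ) : ℂ) ^ M j *
        kronPair q t s (x * a (σ j)) (y * b (τ j)) (suPoint z j) := by
    intro j
    rw [kronPair, kronPair, suPoint_mul, hMl, mul_comm (suPoint z j), mul_inv, ← zpow_neg,
      mul_left_comm _ (q ^ M j), mul_left_comm _ (q ^ (-M j)), kron_zpow_mul hq, kron_zpow_mul hq,
      neg_neg, Units.val_div_eq_div_val, div_zpow, zpow_neg]
    ring
  have hprod : ∏ j, ((s / t : ℂˣ) : ℂ) ^ M j = 1 := by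
    have : ∏ j, (s / t) ^ M j = (s / t) ^ ∑ j, M j := prod_zpow_eq_zpow_sum _ _ _
    rw [hM0, zpow_zero] at this
    have h2 := congrArg Units.val this
    simpa only [Units.coe_prod, Units.val_zpow_eq_zpow_val, Units.val_one] using h2
  rw [sqcdTerm, sqcdTerm]
  simp only [hpair]
  rw [Finset.prod_mul_distrib, hprod, one_mul]

lemma sqcdIntegrand_mul (hq : ‖(q : ℂ)‖ < 1) (hn : 1 ≤ n) (ha : ∏ i, a i = 1)
    (hb : ∏ i, b i = 1) (hG : (sqcdChirals n a b x y).Generic q) (l : Fin n → ℂˣ)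
    (hl : l ∈ qLattice q n) (z : Fin n → ℂˣ) :
    sqcdIntegrand q n a b x y (z * l) = sqcdIntegrand q n a b x y z := by
  have hact := ChiralData.active_mul (sqcdChirals n a b x y) z hl
  by_cases h : ∃ i, i ∈ (sqcdChirals n a b x y).active q z
  · obtain ⟨i, hi⟩ := h
    rw [sqcdIntegrand_eq_zero_of_active hq hi, sqcdIntegrand_eq_zero_of_active hq (hact ▸ hi)]
  · push Not at h
    obtain ⟨t, s, hp⟩ := exists_goodParams hq (x ^ (n + 1)) (y ^ (n + 1))
    have haa := fun i j => theta_div_ne_zero_of_generic_left hq hn hG (i := i) (j := j)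
    have hbb := fun i j => theta_div_ne_zero_of_generic_right hq hn hG (i := i) (j := j)
    rw [sqcdIntegrand_eq hq ha hb haa hbb hp fun i => (theta_arg_ne_zero_iff hq i _).2 (h i),
      sqcdIntegrand_eq hq ha hb haa hbb hp fun i =>
        (theta_arg_ne_zero_iff hq i _).2 (by rw [hact]; exact h i)]
    simp only [sqcdTerm_mul hq _ _ _ _ _ hl]

/-! ### The residues -/

/-- The linear form `∑_k (suWeight j k) u_k`, the logarithm of `ξ_j` up to sign. -/
def suLin (j : Fin (n + 1)) (u : Fin n → ℂ) : ℂ := ∑ k, (suWeight j k : ℂ) * u k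

lemma continuous_suLin (j : Fin (n + 1)) : Continuous (suLin j : (Fin n → ℂ) → ℂ) := by
  unfold suLin
  fun_prop

lemma linForm_eq (i : Mult n) (u : Fin n → ℂ) :
    (sqcdChirals n a b x y).linForm i u = i.sign * suLin i.label u := by
  rw [ChiralData.linForm, suLin, Finset.mul_sum]
  refine Finset.sum_congr rfl fun k _ => ?_
  rw [charge_eq]
  push_cast
  ring

lemma suPoint_expPoint (z : Fin n → ℂˣ) (u : Fin n → ℂ) (j : Fin (n + 1)) :
    suPoint (expPoint z u) j = suPoint z j * expNeg (suLin j u) := by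
  have h : expPoint z u = z * fun k => expNeg (u k) := rfl
  rw [h, suPoint_mul, suLin, ← prod_expNeg_zpow]
  congr 1
  rw [suPoint, ← prod_zpow_suWeight]

lemma neBot_nearFilter (hn : 1 ≤ n) (z : Fin n → ℂˣ) :
    ((sqcdChirals n a b x y).nearFilter q z).NeBot := by
  rw [ChiralData.nearFilter, ← mem_closure_iff_nhdsWithin_neBot]
  have h : Tendsto (fun (ε : ℂ) (_ : Fin n) => ε) (𝓝[≠] 0) (𝓝 0) := by
    have hc : Continuous fun (ε : ℂ) (_ : Fin n) => ε := by fun_prop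
    exact (hc.tendsto 0).mono_left nhdsWithin_le_nhds
  refine mem_closure_of_tendsto h ?_
  filter_upwards [self_mem_nhdsWithin] with ε hε (i : Mult n) _
  have hε : ε ≠ 0 := hε
  have hsign : (i.sign : ℂ) ≠ 0 := by
    have := i.sign_mul_self
    intro h0
    have h1 : i.sign = 0 := by exact_mod_cast h0
    simp [h1] at this
  -- On the diagonal the weights take the values `1` and `-n`.
  have hw : suLin i.label (fun _ : Fin n => ε) ≠ 0 := by
    generalize i.label = j
    rw [suLin, ← Finset.sum_mul]
    refine mul_ne_zero ?_ hε
    refine Fin.lastCases ?_ (fun k => ?_) j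
    · simp [suWeight]
      omega
    · simp [suWeight_eq]
  rw [linForm_eq]
  exact mul_ne_zero hsign hw

/-- The coefficient of `1 / θ` at the pole of a multiplet in the factor of `sqcdTerm` that depends
on the same coordinate; it vanishes unless the flavor is the one selected by the permutation. -/
noncomputable def residueCoeff (q : ℂˣ) (a b : Fin (n + 1) → ℂˣ) (x y t s : ℂˣ)
    (σ τ : Equiv.Perm (Fin (n + 1))) : Mult n → ℂ :=
  Sum.elim
    (fun p => if σ p.2 = p.1 then kron q s (x * a (σ p.2) * (y * b (τ p.2))) else 0)
    (fun p => if τ p.1 = p.2 then kron q t (x * a (σ p.1) * (y * b (τ p.1))) else 0)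

lemma tendsto_kronPair_of_ne_zero (hq : ‖(q : ℂ)‖ < 1) {t s α β ξ : ℂˣ} (ht : theta q t ≠ 0)
    (hs : theta q s ≠ 0) (h1 : theta q (α * ξ) ≠ 0) (h2 : theta q (β * ξ⁻¹) ≠ 0) :
    Tendsto (fun v => kronPair q t s α β (ξ * expNeg v)) (𝓝 0) (𝓝 (kronPair q t s α β ξ)) := by
  have hc := continuous_expNeg
  have e1 : Continuous fun v => α * (ξ * expNeg v) := by fun_prop
  have e2 : Continuous fun v => β * (ξ * expNeg v)⁻¹ := by fun_prop
  have t1 : Tendsto (fun v => α * (ξ * expNeg v)) (𝓝 0) (𝓝 (α * ξ)) := by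
    simpa using e1.tendsto 0
  have t2 : Tendsto (fun v => β * (ξ * expNeg v)⁻¹) (𝓝 0) (𝓝 (β * ξ⁻¹)) := by
    simpa using e2.tendsto 0
  exact ((continuousAt_kron hq ht h1).tendsto.comp t1).mul
    ((continuousAt_kron hq hs h2).tendsto.comp t2)

lemma tendsto_kronPair_pole (hq : ‖(q : ℂ)‖ < 1) (hn : 1 ≤ n)
    (hG : (sqcdChirals n a b x y).Generic q) {t s : ℂˣ} (ht : theta q t ≠ 0) (hs : theta q s ≠ 0)
    (σ τ : Equiv.Perm (Fin (n + 1))) (i : Mult n) :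
    Tendsto (fun v => kronPair q t s (x * a (σ i.label)) (y * b (τ i.label))
        (i.pole a b x y * expNeg v) * (i.sign * v)) (𝓝[≠] 0)
      (𝓝 ((qPoch q q ^ 2)⁻¹ * residueCoeff q a b x y t s σ τ i)) := by
  have hab := theta_mul_ne_zero_of_generic hq hn hG
  have hle : 𝓝[≠] (0 : ℂ) ≤ 𝓝 0 := nhdsWithin_le_nhds
  have hc := continuous_expNeg
  rcases i with ⟨i, j⟩ | ⟨i, j⟩
  · simp only [Mult.label, Mult.pole, Mult.sign, residueCoeff, Sum.elim_inl, Int.cast_one, one_mul]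
    split_ifs with h
    · rw [← h]
      have h1 : Tendsto (fun v => x * a (σ j) * (y * b (τ j)) * (expNeg v)⁻¹) (𝓝[≠] 0)
          (𝓝 (x * a (σ j) * (y * b (τ j)))) := by
        have : Continuous fun v => x * a (σ j) * (y * b (τ j)) * (expNeg v)⁻¹ := by fun_prop
        simpa using (this.tendsto 0).mono_left hle
      refine ((tendsto_kron_expNeg hq ht).mul
        ((continuousAt_kron hq hs (hab (σ j) (τ j))).tendsto.comp h1)).congr fun v => ?_
      have e : y * b (τ j) * ((x * a (σ j))⁻¹ * expNeg v)⁻¹ =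
          x * a (σ j) * (y * b (τ j)) * (expNeg v)⁻¹ := by
        rw [mul_inv, inv_inv, ← mul_assoc, mul_comm (y * b (τ j))]
      rw [kronPair, mul_inv_cancel_left, e, Function.comp_apply]
      ring
    · have h1 : theta q (x * a (σ j) * (x * a i)⁻¹) ≠ 0 := by
        rw [← div_eq_mul_inv, mul_div_mul_left_eq_div]
        exact theta_div_ne_zero_of_generic_left hq hn hG h
      have h2 : theta q (y * b (τ j) * ((x * a i)⁻¹)⁻¹) ≠ 0 := by
        rw [inv_inv, mul_comm]
        exact hab _ _
      have h3 := ((tendsto_kronPair_of_ne_zero hq ht hs h1 h2).mul tendsto_id).mono_left hle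
      rwa [mul_zero] at h3 ⊢
  · simp only [Mult.label, Mult.pole, Mult.sign, residueCoeff, Sum.elim_inr, Int.reduceNeg,
      Int.cast_neg, Int.cast_one, neg_one_mul]
    split_ifs with h
    · rw [← h]
      have h1 : Tendsto (fun v => x * a (σ i) * (y * b (τ i) * expNeg v)) (𝓝[≠] 0)
          (𝓝 (x * a (σ i) * (y * b (τ i)))) := by
        have : Continuous fun v => x * a (σ i) * (y * b (τ i) * expNeg v) := by fun_prop
        simpa using (this.tendsto 0).mono_left hle
      refine ((tendsto_kron_inv_expNeg hq hs).mul
        ((continuousAt_kron hq ht (hab (σ i) (τ i))).tendsto.comp h1)).congr fun v => ?_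
      rw [kronPair, mul_inv, mul_inv_cancel_left, Function.comp_apply]
      ring
    · have h1 : theta q (x * a (σ i) * (y * b j)) ≠ 0 := hab _ _
      have h2 : theta q (y * b (τ i) * (y * b j)⁻¹) ≠ 0 := by
        rw [← div_eq_mul_inv, mul_div_mul_left_eq_div]
        exact theta_div_ne_zero_of_generic_right hq hn hG h
      have h3 := ((tendsto_kronPair_of_ne_zero hq ht hs h1 h2).mul
        (continuous_neg.tendsto (0 : ℂ))).mono_left hle
      rw [neg_zero, mul_zero] at h3
      rwa [mul_zero]

/-- The limit of `sqcdTerm`, cleared of its poles, at the point that omits the label `j₀`: the value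
of the factor at `j₀` times the residues of the other factors. -/
noncomputable def termResidue (q : ℂˣ) (a b : Fin (n + 1) → ℂˣ) (x y t s : ℂˣ)
    (j₀ : Fin (n + 1)) (m : Fin n → Mult n) (σ τ : Equiv.Perm (Fin (n + 1))) : ℂ :=
  kronPair q t s (x * a (σ j₀)) (y * b (τ j₀)) (∏ k, (m k).pole a b x y)⁻¹ *
    ∏ k, ((qPoch q q ^ 2)⁻¹ * residueCoeff q a b x y t s σ τ (m k))

lemma theta_mul_inv_prod_pole_ne_zero (hq : ‖(q : ℂ)‖ < 1)
    (hG : (sqcdChirals n a b x y).Generic q) {j₀ : Fin (n + 1)} {m : Fin n → Mult n}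
    (hm : ∀ k, (m k).label = j₀.succAbove k) (i : Fin (n + 1)) :
    theta q (x * a i * (∏ k, (m k).pole a b x y)⁻¹) ≠ 0 ∧
      theta q (y * b i * ((∏ k, (m k).pole a b x y)⁻¹)⁻¹) ≠ 0 := by
  constructor
  · rw [Ne, theta_eq_zero_iff hq]
    rintro ⟨r, h⟩
    refine inv_prod_pole_ne hG (i := Sum.inl (i, j₀)) hm r ?_
    rw [← h, show Mult.pole a b x y (Sum.inl (i, j₀)) = (x * a i)⁻¹ from rfl, mul_right_comm,
      mul_inv_cancel, one_mul]
  · rw [Ne, theta_eq_zero_iff hq]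
    rintro ⟨r, h⟩
    refine inv_prod_pole_ne hG (i := Sum.inr (j₀, i)) hm (-r) ?_
    rw [zpow_neg, ← h, show Mult.pole a b x y (Sum.inr (j₀, i)) = y * b i from rfl, mul_inv,
      mul_right_comm, inv_mul_cancel, one_mul, inv_inv]

lemma tendsto_suLin_nearFilter {z : Fin n → ℂˣ} {i : Mult n}
    (hi : i ∈ (sqcdChirals n a b x y).active q z) :
    Tendsto (suLin i.label) ((sqcdChirals n a b x y).nearFilter q z) (𝓝[≠] 0) := by
  refine tendsto_nhdsWithin_iff.2 ⟨?_, ?_⟩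
  · have h0 : suLin i.label (0 : Fin n → ℂ) = 0 := by simp [suLin]
    have := ((continuous_suLin i.label).tendsto (0 : Fin n → ℂ)).mono_left
      (nhdsWithin_le_nhds
        (s := {u | ∀ i ∈ (sqcdChirals n a b x y).active q z,
          (sqcdChirals n a b x y).linForm i u ≠ 0}))
    rwa [h0] at this
  · have : ∀ᶠ u in (sqcdChirals n a b x y).nearFilter q z,
        ∀ i ∈ (sqcdChirals n a b x y).active q z, (sqcdChirals n a b x y).linForm i u ≠ 0 :=
      self_mem_nhdsWithin
    filter_upwards [this] with u hu h0
    have := hu i hi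
    rw [linForm_eq, h0, mul_zero] at this
    exact this rfl

lemma arg_expPoint (i : Mult n) (z : Fin n → ℂˣ) (u : Fin n → ℂ) :
    (sqcdChirals n a b x y).arg i (expPoint z u) =
      (sqcdChirals n a b x y).arg i z * expNeg ((sqcdChirals n a b x y).linForm i u) := by
  have h : expPoint z u = z * fun k => expNeg (u k) := rfl
  rw [h, ChiralData.arg_mul, prod_expNeg_zpow]
  rfl

lemma eventually_theta_arg_ne_zero (hq : ‖(q : ℂ)‖ < 1) (z : Fin n → ℂˣ) (i : Mult n) :
    ∀ᶠ u in (sqcdChirals n a b x y).nearFilter q z,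
      theta q ((sqcdChirals n a b x y).arg i (expPoint z u)) ≠ 0 := by
  have hlin : Continuous fun u : Fin n → ℂ => (sqcdChirals n a b x y).linForm i u := by
    simp only [linForm_eq]
    exact continuous_const.mul (continuous_suLin _)
  have hlin0 : (sqcdChirals n a b x y).linForm i (0 : Fin n → ℂ) = 0 := by
    simp [ChiralData.linForm]
  by_cases hi : i ∈ (sqcdChirals n a b x y).active q z
  · have hnear : ∀ᶠ u in (sqcdChirals n a b x y).nearFilter q z,
        ∀ i ∈ (sqcdChirals n a b x y).active q z, (sqcdChirals n a b x y).linForm i u ≠ 0 :=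
      self_mem_nhdsWithin
    have h1 : Tendsto (fun u => (sqcdChirals n a b x y).linForm i u)
        ((sqcdChirals n a b x y).nearFilter q z) (𝓝[≠] 0) := by
      refine tendsto_nhdsWithin_iff.2 ⟨?_, hnear.mono fun u hu => hu i hi⟩
      have := hlin.tendsto 0
      rw [hlin0] at this
      exact this.mono_left nhdsWithin_le_nhds
    obtain ⟨m, hm⟩ : ∃ m : ℤ, (sqcdChirals n a b x y).arg i z = q ^ m := by
      simpa [ChiralData.active] using hi
    filter_upwards [h1.eventually (eventually_theta_expNeg_ne_zero hq)] with u hu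
    rwa [arg_expPoint, hm, Ne, theta_zpow_mul_eq_zero_iff hq]
  · have h1 := (theta_arg_ne_zero_iff (a := a) (b := b) (x := x) (y := y) hq i z).2 hi
    have hc : Continuous fun u : Fin n → ℂ =>
        theta q ((sqcdChirals n a b x y).arg i (expPoint z u)) := by
      simp only [arg_expPoint]
      exact (continuous_theta hq).comp (continuous_const.mul (continuous_expNeg.comp hlin))
    have h2 := hc.tendsto 0
    rw [arg_expPoint, hlin0, expNeg_zero, mul_one] at h2
    exact (h2.mono_left nhdsWithin_le_nhds).eventually_ne h1

lemma tendsto_cleared (hq : ‖(q : ℂ)‖ < 1) (hn : 1 ≤ n) (ha : ∏ i, a i = 1) (hb : ∏ i, b i = 1)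
    (hG : (sqcdChirals n a b x y).Generic q) {t s : ℂˣ}
    (hp : GoodParams q (x ^ (n + 1)) (y ^ (n + 1)) t s) {j₀ : Fin (n + 1)} {m : Fin n → Mult n}
    (hm : ∀ k, (m k).label = j₀.succAbove k) :
    Tendsto ((sqcdChirals n a b x y).cleared q (sqcdIntegrand q n a b x y)
        (meetPoint a b x y j₀ m))
      ((sqcdChirals n a b x y).nearFilter q (meetPoint a b x y j₀ m))
      (𝓝 (sqcdConst q a b x y t s *
        ∑ σ : Equiv.Perm (Fin (n + 1)), ∑ τ : Equiv.Perm (Fin (n + 1)),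
          (((Equiv.Perm.sign σ : ℤ) : ℂ) * ((Equiv.Perm.sign τ : ℤ) : ℂ)) *
            termResidue q a b x y t s j₀ m σ τ)) := by
  set z := meetPoint a b x y j₀ m with hz
  have hact : (sqcdChirals n a b x y).active q z = Finset.univ.image m := active_meetPoint hG hm
  have hterm : ∀ σ τ : Equiv.Perm (Fin (n + 1)),
      Tendsto (fun u => sqcdTerm q a b x y t s σ τ (expPoint z u) *
        ∏ i ∈ (sqcdChirals n a b x y).active q z, (sqcdChirals n a b x y).linForm i u)
        ((sqcdChirals n a b x y).nearFilter q z) (𝓝 (termResidue q a b x y t s j₀ m σ τ)) := by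
    intro σ τ
    have hlast : Tendsto (fun u => kronPair q t s (x * a (σ j₀)) (y * b (τ j₀))
        (suPoint (expPoint z u) j₀)) ((sqcdChirals n a b x y).nearFilter q z)
        (𝓝 (kronPair q t s (x * a (σ j₀)) (y * b (τ j₀)) (∏ k, (m k).pole a b x y)⁻¹)) := by
      have h1 := tendsto_kronPair_of_ne_zero hq hp.ht hp.hs
        (theta_mul_inv_prod_pole_ne_zero hq hG hm (σ j₀)).1
        (theta_mul_inv_prod_pole_ne_zero hq hG hm (τ j₀)).2
      have h2 : Tendsto (suLin j₀) ((sqcdChirals n a b x y).nearFilter q z) (𝓝 0) := by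
        have := ((continuous_suLin j₀).tendsto (0 : Fin n → ℂ))
        rw [show suLin j₀ (0 : Fin n → ℂ) = 0 by simp [suLin]] at this
        exact this.mono_left nhdsWithin_le_nhds
      refine (h1.comp h2).congr fun u => ?_
      rw [suPoint_expPoint, hz, suPoint_meetPoint]
      simp
    have hrest : ∀ k : Fin n, Tendsto (fun u => kronPair q t s (x * a (σ (j₀.succAbove k)))
        (y * b (τ (j₀.succAbove k))) (suPoint (expPoint z u) (j₀.succAbove k)) *
          (sqcdChirals n a b x y).linForm (m k) u) ((sqcdChirals n a b x y).nearFilter q z)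
        (𝓝 ((qPoch q q ^ 2)⁻¹ * residueCoeff q a b x y t s σ τ (m k))) := by
      intro k
      have hk : m k ∈ (sqcdChirals n a b x y).active q z := by
        rw [hact]
        exact Finset.mem_image_of_mem _ (Finset.mem_univ _)
      have h1 := (tendsto_kronPair_pole hq hn hG hp.ht hp.hs σ τ (m k)).comp
        (tendsto_suLin_nearFilter hk)
      refine h1.congr fun u => ?_
      rw [suPoint_expPoint, hz, suPoint_meetPoint, linForm_eq]
      simp [hm]
    refine (hlast.mul (tendsto_finsetProd _ fun k _ => hrest k)).congr fun u => ?_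
    rw [sqcdTerm, Fin.prod_univ_succAbove _ j₀, hact,
      Finset.prod_image fun i _ j _ h => injective_of_label hm h, Finset.prod_mul_distrib, mul_assoc]
  have hsum := (tendsto_finsetSum Finset.univ fun (σ : Equiv.Perm (Fin (n + 1))) _ =>
    tendsto_finsetSum Finset.univ fun (τ : Equiv.Perm (Fin (n + 1))) _ =>
      (hterm σ τ).const_mul (((Equiv.Perm.sign σ : ℤ) : ℂ) * ((Equiv.Perm.sign τ : ℤ) : ℂ))).const_mul
        (sqcdConst q a b x y t s)
  refine hsum.congr' ?_
  filter_upwards [eventually_all.2 fun i => eventually_theta_arg_ne_zero hq z i] with u hu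
  have haa := fun i j => theta_div_ne_zero_of_generic_left hq hn hG (i := i) (j := j)
  have hbb := fun i j => theta_div_ne_zero_of_generic_right hq hn hG (i := i) (j := j)
  rw [ChiralData.cleared, sqcdIntegrand_eq hq ha hb haa hbb hp hu, mul_assoc, Finset.sum_mul]
  simp only [Finset.sum_mul, mul_assoc]

lemma jkWellDefined_sqcd (hq : ‖(q : ℂ)‖ < 1) (hn : 1 ≤ n) (ha : ∏ i, a i = 1)
    (hb : ∏ i, b i = 1) (hG : (sqcdChirals n a b x y).Generic q) :
    (sqcdChirals n a b x y).JKWellDefined q (sqcdIntegrand q n a b x y) where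
  elliptic := sqcdIntegrand_mul hq hn ha hb hG
  finite := finite_card_active_eq hG
  limit z hz := by
    obtain ⟨j₀, m, hm, hm'⟩ := exists_section hG hz
    obtain ⟨l, hl, rfl⟩ := exists_eq_meetPoint_mul hm hm'
    obtain ⟨t, s, hp⟩ := exists_goodParams hq (x ^ (n + 1)) (y ^ (n + 1))
    rw [ChiralData.cleared_mul _ (sqcdIntegrand_mul hq hn ha hb hG) _ hl,
      ChiralData.nearFilter_mul _ _ hl]
    exact ⟨_, tendsto_cleared hq hn ha hb hG hp hm⟩

/-! ### Summation of the residues -/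

/-- The jumps of a function of the upper level sets of `η` add up telescopically. -/
lemma sum_sub_eq_of_injective {ι : Type*} [Fintype ι] {η : ι → ℝ}
    (hη : Function.Injective η) (F : Finset ι → ℂ) :
    ∑ j, (F {k | η j ≤ η k} - F {k | η j < η k}) = F Finset.univ - F ∅ := by
  classical
  have key : ∀ S : Finset ι, ∑ j ∈ S, (F (S.filter fun k => η j ≤ η k) -
      F (S.filter fun k => η j < η k)) = F S - F ∅ := by
    intro S
    induction S using Finset.induction_on_min_value η with
    | empty => simp
    | insert c S hc hmin ih =>
      have hlt : ∀ k ∈ S, η c < η k := fun k hk =>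
        lt_of_le_of_ne (hmin k hk) fun h => hc (hη h ▸ hk)
      rw [Finset.sum_insert hc]
      have e1 : (insert c S).filter (fun k => η c ≤ η k) = insert c S :=
        Finset.filter_true_of_mem fun k hk => by
          rcases Finset.mem_insert.1 hk with rfl | hk
          · exact le_rfl
          · exact hmin k hk
      have e2 : (insert c S).filter (fun k => η c < η k) = S := by
        rw [Finset.filter_insert, if_neg (lt_irrefl _)]
        exact Finset.filter_true_of_mem hlt
      have e3 : ∀ j ∈ S, F ((insert c S).filter fun k => η j ≤ η k) -
          F ((insert c S).filter fun k => η j < η k) =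
          F (S.filter fun k => η j ≤ η k) - F (S.filter fun k => η j < η k) := by
        intro j hj
        rw [Finset.filter_insert, Finset.filter_insert, if_neg (hlt j hj).not_ge,
          if_neg (hlt j hj).not_gt]
      rw [e1, e2, Finset.sum_congr rfl e3, ih]
      ring
  exact key Finset.univ

/-- The sum of the contributions of one term to all residues: the partial fraction expansion of the
factor of the omitted coordinate turns the sum over the omitted label into a telescoping sum. -/
lemma sum_termResidue (hq : ‖(q : ℂ)‖ < 1) (hn : 1 ≤ n) (ha : ∏ i, a i = 1) (hb : ∏ i, b i = 1)
    (hG : (sqcdChirals n a b x y).Generic q) {t s : ℂˣ}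
    (hp : GoodParams q (x ^ (n + 1)) (y ^ (n + 1)) t s) {η : Fin n → ℝ}
    (hη : Function.Injective (extend η)) (σ τ : Equiv.Perm (Fin (n + 1))) :
    ∑ j₀, ∑ i : Fin n → Fin (n + 1), termResidue q a b x y t s j₀ (coneSection η j₀ i) σ τ =
      (qPoch q q ^ (2 * n))⁻¹ *
        ((∏ j, kron q s (x * a (σ j) * (y * b (τ j)))) * kron q (t / s) (x ^ (n + 1)) -
          (∏ j, kron q t (x * a (σ j) * (y * b (τ j)))) * kron q (t / s) (y ^ (n + 1))⁻¹) := by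
  classical
  set A : Fin (n + 1) → ℂ := fun j => kron q s (x * a (σ j) * (y * b (τ j))) with hA
  set B : Fin (n + 1) → ℂ := fun j => kron q t (x * a (σ j) * (y * b (τ j))) with hB
  set F : Finset (Fin (n + 1)) → ℂ := fun H => (∏ j, if j ∈ H then A j else B j) *
    kron q (t / s) (∏ j, if j ∈ H then x * a (σ j) else (y * b (τ j))⁻¹) with hF
  have hterm : ∀ j₀, ∑ i : Fin n → Fin (n + 1),
      termResidue q a b x y t s j₀ (coneSection η j₀ i) σ τ =
      (qPoch q q ^ (2 * n))⁻¹ * (F {k | extend η j₀ ≤ extend η k} -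
        F {k | extend η j₀ < extend η k}) := by
    intro j₀
    -- Only the flavors selected by the permutations contribute.
    set i₀ : Fin n → Fin (n + 1) := fun k =>
      if extend η j₀ < extend η (j₀.succAbove k) then σ (j₀.succAbove k)
        else τ (j₀.succAbove k) with hi₀
    have hcoeff : ∀ i : Fin n → Fin (n + 1), ∀ k,
        residueCoeff q a b x y t s σ τ (coneSection η j₀ i k) =
        if i₀ k = i k then (if extend η j₀ < extend η (j₀.succAbove k)
          then A (j₀.succAbove k) else B (j₀.succAbove k)) else 0 := by
      intro i k
      by_cases h : extend η j₀ < extend η (j₀.succAbove k) <;>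
        simp [coneSection, Mult.mk, h, residueCoeff, hi₀, hA, hB]
    rw [Finset.sum_eq_single i₀]
    rotate_left
    · intro i _ hi
      obtain ⟨k, hk⟩ := Function.ne_iff.1 hi
      rw [termResidue, Finset.prod_eq_zero (Finset.mem_univ k), mul_zero]
      rw [hcoeff, if_neg (Ne.symm hk), mul_zero]
    · intro h
      exact absurd (Finset.mem_univ _) h
    have hpole : ∏ k, (coneSection η j₀ i₀ k).pole a b x y = (∏ k, if extend η j₀ <
        extend η (j₀.succAbove k) then x * a (σ (j₀.succAbove k)) else
          (y * b (τ (j₀.succAbove k)))⁻¹)⁻¹ := by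
      rw [← Finset.prod_inv_distrib]
      refine Finset.prod_congr rfl fun k _ => ?_
      by_cases h : extend η j₀ < extend η (j₀.succAbove k)
      · simp [coneSection, Mult.mk, h, hi₀, Mult.pole]
      · simp [coneSection, Mult.mk, h, hi₀, Mult.pole]
    have hne := theta_mul_inv_prod_pole_ne_zero hq hG (label_coneSection η j₀ i₀)
    have h1 := (hne (σ j₀)).1
    have h2 := (hne (τ j₀)).2
    rw [hpole, inv_inv] at h1 h2
    set P : ℂˣ := ∏ k, if extend η j₀ < extend η (j₀.succAbove k)
      then x * a (σ (j₀.succAbove k)) else (y * b (τ (j₀.succAbove k)))⁻¹ with hP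
    have e0 : x * a (σ j₀) * P * (y * b (τ j₀) * P⁻¹) = x * a (σ j₀) * (y * b (τ j₀)) := by
      rw [mul_mul_mul_comm, mul_inv_cancel, mul_one]
    have hfrac := kron_mul_kron hq hp.ht hp.hs hp.hts h1 h2
      (by rw [e0]; exact theta_mul_ne_zero_of_generic hq hn hG _ _)
    rw [e0, mul_inv, inv_inv] at hfrac
    have hle : F {k | extend η j₀ ≤ extend η k} = A j₀ * (∏ k, if extend η j₀ <
        extend η (j₀.succAbove k) then A (j₀.succAbove k) else B (j₀.succAbove k)) *
        kron q (t / s) (x * a (σ j₀) * P) := by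
      have : ∀ k, (extend η j₀ ≤ extend η (j₀.succAbove k) ↔
          extend η j₀ < extend η (j₀.succAbove k)) := fun k =>
        ⟨fun h => lt_of_le_of_ne h fun h' => Fin.succAbove_ne j₀ k (hη h').symm, le_of_lt⟩
      simp only [hF, Fin.prod_univ_succAbove _ j₀, Finset.mem_filter, Finset.mem_univ, true_and,
        le_refl, if_true, this, hP]
    have hlt : F {k | extend η j₀ < extend η k} = B j₀ * (∏ k, if extend η j₀ <
        extend η (j₀.succAbove k) then A (j₀.succAbove k) else B (j₀.succAbove k)) *
        kron q (t / s) ((y * b (τ j₀))⁻¹ * P) := by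
      simp only [hF, Fin.prod_univ_succAbove _ j₀, Finset.mem_filter, Finset.mem_univ, true_and,
        lt_irrefl, if_false, hP]
    rw [termResidue, hpole, inv_inv, Finset.prod_mul_distrib, Finset.prod_const, Finset.card_univ,
      Fintype.card_fin, inv_pow, ← pow_mul, kronPair, hfrac, hle, hlt]
    simp only [hcoeff, if_true]
    ring
  simp only [hterm]
  rw [← Finset.mul_sum, sum_sub_eq_of_injective hη]
  have eX : ∏ j, x * a (σ j) = x ^ (n + 1) := prod_const_mul (by rw [Equiv.prod_comp σ a, ha])
  have eY : ∏ j, y * b (τ j) = y ^ (n + 1) := prod_const_mul (by rw [Equiv.prod_comp τ b, hb])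
  simp only [hF, Finset.mem_univ, if_true, Finset.notMem_empty, if_false, Finset.prod_inv_distrib,
    eX, eY]

lemma sum_sign_mul_prod {m : ℕ} (M : Matrix (Fin m) (Fin m) ℂ) :
    ∑ σ : Equiv.Perm (Fin m), ∑ τ : Equiv.Perm (Fin m),
      (((Equiv.Perm.sign σ : ℤ) : ℂ) * ((Equiv.Perm.sign τ : ℤ) : ℂ)) * ∏ j, M (σ j) (τ j) =
    m.factorial * M.det := by
  rw [Finset.sum_comm]
  have h : ∀ τ : Equiv.Perm (Fin m), ∑ σ : Equiv.Perm (Fin m),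
      (((Equiv.Perm.sign σ : ℤ) : ℂ) * ((Equiv.Perm.sign τ : ℤ) : ℂ)) * ∏ j, M (σ j) (τ j) =
      M.det := by
    intro τ
    have h1 := Matrix.det_permute' τ M
    rw [Matrix.det_apply'] at h1
    have h2 : ((Equiv.Perm.sign τ : ℤ) : ℂ) * ((Equiv.Perm.sign τ : ℤ) : ℂ) = 1 := by
      rw [← Int.cast_mul, ← Units.val_mul, Int.units_mul_self]
      simp
    calc _ = ((Equiv.Perm.sign τ : ℤ) : ℂ) * ∑ σ : Equiv.Perm (Fin m),
          ((Equiv.Perm.sign σ : ℤ) : ℂ) * ∏ j, (M.submatrix id τ) (σ j) j := by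
          rw [Finset.mul_sum]
          refine Finset.sum_congr rfl fun σ _ => ?_
          simp only [Matrix.submatrix_apply, id_eq]
          ring
      _ = _ := by rw [h1, ← mul_assoc, h2, one_mul]
  simp only [h, Finset.sum_const, Finset.card_univ, Fintype.card_perm, Fintype.card_fin,
    nsmul_eq_mul]

/-- The telescoped residues of the terms add up to two Frobenius determinants, which Fay's identity
combines into the closed form. The auxiliary parameters `t`, `s` drop out. -/
lemma sqcdIndex_eq (hq : ‖(q : ℂ)‖ < 1) (hn : 1 ≤ n) (ha : ∏ i, a i = 1) (hb : ∏ i, b i = 1)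
    (hG : (sqcdChirals n a b x y).Generic q) {η : Fin n → ℝ}
    (hη : (sqcdChirals n a b x y).IsRegular η) :
    sqcdIndex q n a b x y η = theta q (x ^ (n + 1) * y ^ (n + 1)) /
      (theta q (x ^ (n + 1)) * theta q (y ^ (n + 1)) *
        ∏ i, ∏ j, theta q (x * y * a i * b j)) := by
  have hη' := extend_injective hη
  obtain ⟨t, s, hp⟩ := exists_goodParams hq (x ^ (n + 1)) (y ^ (n + 1))
  have hX := theta_pow_ne_zero_of_generic_left hq ha hG
  have hY := theta_pow_ne_zero_of_generic_right hq hb hG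
  have hab := theta_mul_ne_zero_of_generic hq hn hG
  have hlim : ∀ j₀ i, limUnder ((sqcdChirals n a b x y).nearFilter q
      (meetPoint a b x y j₀ (coneSection η j₀ i)))
      ((sqcdChirals n a b x y).cleared q (sqcdIntegrand q n a b x y)
        (meetPoint a b x y j₀ (coneSection η j₀ i))) = sqcdConst q a b x y t s *
        ∑ σ : Equiv.Perm (Fin (n + 1)), ∑ τ : Equiv.Perm (Fin (n + 1)),
          (((Equiv.Perm.sign σ : ℤ) : ℂ) * ((Equiv.Perm.sign τ : ℤ) : ℂ)) *
            termResidue q a b x y t s j₀ (coneSection η j₀ i) σ τ := by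
    intro j₀ i
    have := neBot_nearFilter (a := a) (b := b) (x := x) (y := y) (q := q) hn
      (meetPoint a b x y j₀ (coneSection η j₀ i))
    exact (tendsto_cleared hq hn ha hb hG hp (label_coneSection η j₀ i)).limUnder_eq
  have hsum : ∑ j₀, ∑ i : Fin n → Fin (n + 1),
      ∑ σ : Equiv.Perm (Fin (n + 1)), ∑ τ : Equiv.Perm (Fin (n + 1)),
          (((Equiv.Perm.sign σ : ℤ) : ℂ) * ((Equiv.Perm.sign τ : ℤ) : ℂ)) *
            termResidue q a b x y t s j₀ (coneSection η j₀ i) σ τ =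
      ∑ σ : Equiv.Perm (Fin (n + 1)), ∑ τ : Equiv.Perm (Fin (n + 1)),
          (((Equiv.Perm.sign σ : ℤ) : ℂ) * ((Equiv.Perm.sign τ : ℤ) : ℂ)) *
            ∑ j₀, ∑ i : Fin n → Fin (n + 1),
              termResidue q a b x y t s j₀ (coneSection η j₀ i) σ τ := by
    simp only [Finset.mul_sum]
    refine (Finset.sum_congr rfl fun _ _ => Finset.sum_comm).trans (Finset.sum_comm.trans ?_)
    refine Finset.sum_congr rfl fun _ _ => ?_
    exact (Finset.sum_congr rfl fun _ _ => Finset.sum_comm).trans Finset.sum_comm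
  have d1 := det_kron hq (fun i => x * a i) (fun j => y * b j) hab hp.hs
  have d2 := det_kron hq (fun i => x * a i) (fun j => y * b j) hab hp.ht
  rw [prod_const_mul ha, prod_const_mul hb] at d1 d2
  have s1 := sum_sign_mul_prod (Matrix.of fun i j => kron q s (x * a i * (y * b j)))
  have s2 := sum_sign_mul_prod (Matrix.of fun i j => kron q t (x * a i * (y * b j)))
  simp only [Matrix.of_apply] at s1 s2
  have hfinal : ∑ σ : Equiv.Perm (Fin (n + 1)), ∑ τ : Equiv.Perm (Fin (n + 1)),
      (((Equiv.Perm.sign σ : ℤ) : ℂ) * ((Equiv.Perm.sign τ : ℤ) : ℂ)) *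
        ∑ j₀, ∑ i : Fin n → Fin (n + 1),
          termResidue q a b x y t s j₀ (coneSection η j₀ i) σ τ =
      (qPoch q q ^ (2 * n))⁻¹ * ((n + 1).factorial *
        ((Matrix.of fun i j => kron q s (x * a i * (y * b j))).det * kron q (t / s) (x ^ (n + 1)) -
        (Matrix.of fun i j => kron q t (x * a i * (y * b j))).det *
          kron q (t / s) (y ^ (n + 1))⁻¹)) := by
    rw [mul_sub, ← mul_assoc, ← mul_assoc, ← s1, ← s2]
    simp only [sum_termResidue hq hn ha hb hG hp hη', Finset.sum_mul, ← Finset.sum_sub_distrib,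
      Finset.mul_sum]
    refine Finset.sum_congr rfl fun σ _ => Finset.sum_congr rfl fun τ _ => ?_
    ring
  have hfay := theta_mul_kron_mul_kron hq hp.ht hp.hs hp.hts hX hY
  have hprod : ∏ i, ∏ j, theta q (x * y * a i * b j) = ∏ i, ∏ j, theta q (x * a i * (y * b j)) := by
    refine Finset.prod_congr rfl fun i _ => Finset.prod_congr rfl fun j _ => ?_
    congr 1
    rw [mul_mul_mul_comm, mul_assoc (x * y)]
  have hbr : (Matrix.of fun i j => kron q s (x * a i * (y * b j))).det *
      kron q (t / s) (x ^ (n + 1)) - (Matrix.of fun i j => kron q t (x * a i * (y * b j))).det *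
        kron q (t / s) (y ^ (n + 1))⁻¹ =
      (ellVandermonde q (fun i => x * a i) * ellVandermonde q fun j => y * b j) /
        (∏ i, ∏ j, theta q (x * a i * (y * b j))) * (theta q (x ^ (n + 1) * y ^ (n + 1)) *
          (kron q t (x ^ (n + 1)) * kron q s (y ^ (n + 1)))) := by
    rw [d1, d2, hfay]
    ring
  rw [sqcdIndex, jkIntegral_eq_sum hG (sqcdIntegrand_mul hq hn ha hb hG) hη']
  simp only [hlim, ← Finset.mul_sum]
  rw [hsum, hfinal, hbr, hprod, sqcdConst, kron, kron]
  have hφ := qPoch_self_ne_zero hq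
  have n1 := ellVandermonde_mul_ne_zero (c := x) fun i j =>
    theta_div_ne_zero_of_generic_left hq hn hG (i := i) (j := j)
  have n2 := ellVandermonde_mul_ne_zero (c := y) fun i j =>
    theta_div_ne_zero_of_generic_right hq hn hG (i := i) (j := j)
  have n3 : ∏ i, ∏ j, theta q (x * a i * (y * b j)) ≠ 0 :=
    Finset.prod_ne_zero_iff.2 fun _ _ => Finset.prod_ne_zero_iff.2 fun _ _ => hab _ _
  have n4 : ((n + 1).factorial : ℂ) ≠ 0 := by exact_mod_cast (n + 1).factorial_ne_zero
  have := hp.ht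
  have := hp.hs
  have := hp.htX
  have := hp.hsY
  field_simp

/-! ### Relabelling the multiplets and gluing -/

namespace ChiralData

variable {r : ℕ} {ι ι' : Type} {z : Fin r → ℂˣ}
  {D : ChiralData r ι} {e : ι' ≃ ι} {f : (Fin r → ℂˣ) → ℂ} {η : Fin r → ℝ}

/-- The same multiplets, labelled by another index type. -/
def reindex (D : ChiralData r ι) (e : ι' ≃ ι) : ChiralData r ι' :=
  ⟨D.charge ∘ e, D.fug ∘ e⟩

lemma realCharge_reindex (i : ι') : (D.reindex e).realCharge i = D.realCharge (e i) := rfl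

lemma linForm_reindex (i : ι') : (D.reindex e).linForm i = D.linForm (e i) := rfl

lemma isRegular_of_isRegular_reindex (h : (D.reindex e).IsRegular η) : D.IsRegular η := by
  rintro S hS ⟨t, ht, rfl⟩
  refine h (S.map e.symm.toEmbedding) (by rwa [Finset.card_map]) ⟨t ∘ e, fun i hi => ?_, ?_⟩
  · obtain ⟨j, hj, rfl⟩ := Finset.mem_map.1 hi
    simpa using ht j hj
  · simp [realCharge_reindex]

lemma openCone_reindex (S : Finset ι) :
    (D.reindex e).openCone (S.map e.symm.toEmbedding) = D.openCone S := by
  ext η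
  constructor
  · rintro ⟨t, ht, rfl⟩
    refine ⟨t ∘ e.symm, fun i hi => ht _ (Finset.mem_map_of_mem _ hi), ?_⟩
    simp [realCharge_reindex]
  · rintro ⟨t, ht, rfl⟩
    refine ⟨t ∘ e, fun i hi => ?_, ?_⟩
    · obtain ⟨j, hj, rfl⟩ := Finset.mem_map.1 hi
      simpa using ht j hj
    · simp [realCharge_reindex]

variable [Fintype ι] [Fintype ι']

lemma mem_active_reindex {i : ι'} : i ∈ (D.reindex e).active q z ↔ e i ∈ D.active q z := by
  simp only [active, Finset.mem_filter, Finset.mem_univ, true_and]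
  rfl

lemma active_reindex : (D.reindex e).active q z = (D.active q z).map e.symm.toEmbedding := by
  ext i
  simp [mem_active_reindex, Finset.mem_map_equiv]

lemma card_active_reindex : ((D.reindex e).active q z).card = (D.active q z).card := by
  rw [active_reindex, Finset.card_map]

lemma generic_of_generic_reindex (h : (D.reindex e).Generic q) : D.Generic q := by
  intro z
  have := LinearIndependent.comp (h z) (fun i : (D.active q z : Set ι) =>
    (⟨e.symm i, by simp [mem_active_reindex]⟩ : ((D.reindex e).active q z : Set ι')))
    (fun i j hij => Subtype.ext (e.symm.injective (congrArg Subtype.val hij)))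
  simp only [Function.comp_def, realCharge_reindex, Equiv.apply_symm_apply] at this
  exact this

lemma nearFilter_reindex : (D.reindex e).nearFilter q z = D.nearFilter q z := by
  have : {u | ∀ i ∈ (D.reindex e).active q z, (D.reindex e).linForm i u ≠ 0} =
      {u | ∀ i ∈ D.active q z, D.linForm i u ≠ 0} := by
    ext u
    simp only [mem_active_reindex, linForm_reindex]
    exact e.forall_congr_left.trans (by simp)
  rw [nearFilter, this, nearFilter]

lemma cleared_reindex : (D.reindex e).cleared q f z = D.cleared q f z := by
  ext u
  simp [cleared, active_reindex, linForm_reindex]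

lemma jkResidue_reindex : (D.reindex e).jkResidue q η f z = D.jkResidue q η f z := by
  classical
  unfold jkResidue
  by_cases h : (D.active q z).card = r
  · have h' : ((D.reindex e).active q z).card = r := card_active_reindex.trans h
    rw [dif_pos h, dif_pos h', nearFilter_reindex, cleared_reindex]
    have hcone : (D.reindex e).openCone ((D.reindex e).active q z) =
        D.openCone (D.active q z) := by rw [active_reindex, openCone_reindex]
    rw [hcone]
    -- The two labellings of the active charges differ by a permutation.
    let π : Equiv.Perm (Fin r) := (Finset.equivFinOfCardEq h').symm.trans
      ((e.subtypeEquiv fun i => mem_active_reindex).trans (Finset.equivFinOfCardEq h))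
    have hdet : (Matrix.of fun j k : Fin r =>
        (D.reindex e).charge ((Finset.equivFinOfCardEq h').symm j : ι') k) =
        (Matrix.of fun j k : Fin r =>
          D.charge ((Finset.equivFinOfCardEq h).symm j : ι) k).submatrix π id := by
      ext j k
      have : ((Finset.equivFinOfCardEq h).symm (π j) : ι) =
          e ((Finset.equivFinOfCardEq h').symm j) := by simp [π]
      rw [Matrix.submatrix_apply, Matrix.of_apply, Matrix.of_apply, this]
      rfl
    rw [hdet, Matrix.det_permute, Int.natAbs_mul, Int.cast_id, Int.units_natAbs, one_mul]
  · rw [dif_neg h, dif_neg (by rwa [card_active_reindex])]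

lemma jkIntegral_reindex : (D.reindex e).jkIntegral q η f = D.jkIntegral q η f := by
  simp only [jkIntegral, jkResidue_reindex]

lemma JKWellDefined.reindex (h : D.JKWellDefined q f) : (D.reindex e).JKWellDefined q f where
  elliptic := h.elliptic
  finite := by simpa only [card_active_reindex] using h.finite
  limit z hz := by
    rw [cleared_reindex, nearFilter_reindex]
    exact h.limit z (card_active_reindex.symm.trans hz)

lemma cleared_const_mul (c : ℂ) (z : Fin r → ℂˣ) :
    D.cleared q (fun z => c * f z) z = fun u => c * D.cleared q f z u := by
  ext u
  simp only [cleared, mul_assoc]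

lemma JKWellDefined.const_mul (h : D.JKWellDefined q f) (c : ℂ) :
    D.JKWellDefined q fun z => c * f z where
  elliptic l hl z := by rw [h.elliptic l hl z]
  finite := h.finite
  limit z hz := by
    obtain ⟨L, hL⟩ := h.limit z hz
    exact ⟨c * L, by simpa only [cleared_const_mul] using hL.const_mul c⟩

lemma jkIntegral_const_mul (h : D.JKWellDefined q f) [∀ z, (D.nearFilter q z).NeBot] (c : ℂ) :
    D.jkIntegral q η (fun z => c * f z) = c * D.jkIntegral q η f := by
  have hres : ∀ z, D.jkResidue q η (fun z => c * f z) z = c * D.jkResidue q η f z := by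
    intro z
    unfold jkResidue
    split_ifs with h1 h2
    · obtain ⟨L, hL⟩ := h.limit z h1
      have := hL.const_mul c
      rw [cleared_const_mul, hL.limUnder_eq, this.limUnder_eq]
      ring
    · simp
    · simp
  simp only [jkIntegral, hres]
  exact (mul_finsum _ _).symm

end ChiralData

/-- The multiplets of the glued theory are, up to their labels, those of SQCD with the two sets of
flavors interchanged and inverted. -/
lemma gluedChirals_eq (n : ℕ) (a b : Fin (n + 1) → ℂˣ) (x y : ℂˣ) :
    gluedChirals n a b x y = (sqcdChirals n b⁻¹ a y⁻¹ x).reindex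
      ((Equiv.sumComm _ _).trans ((Equiv.prodComm _ _).sumCongr (Equiv.prodComm _ _))) := by
  simp only [gluedChirals, sqcdChirals, ChiralData.reindex, ChiralData.mk.injEq]
  constructor <;> ext (p | p) <;> simp

/-- The numerators `θ(q / x^N)` and `θ(q y^N)` of the two copies do not depend on `z`. -/
lemma gluedIntegrand_eq (z : Fin n → ℂˣ) :
    gluedIntegrand q n a b x y z = theta q (x ^ (n + 1)) * theta q (y⁻¹ ^ (n + 1)) *
      sqcdIntegrand q n b⁻¹ a y⁻¹ x z := by
  have h1 : ∏ i, ∏ j, theta q (y⁻¹ * b⁻¹ i * suPoint z j) =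
      ∏ i, ∏ j, theta q (1 / y * suPoint z i * b⁻¹ j) := by
    rw [Finset.prod_comm]
    refine Finset.prod_congr rfl fun i _ => Finset.prod_congr rfl fun j _ => ?_
    rw [one_div, mul_right_comm]
  have h2 : ∏ i, ∏ j, theta q (x * (suPoint z)⁻¹ i * a j) =
      ∏ i, ∏ j, theta q (x * a i * (suPoint z)⁻¹ j) := by
    rw [Finset.prod_comm]
    refine Finset.prod_congr rfl fun i _ => Finset.prod_congr rfl fun j _ => ?_
    rw [mul_right_comm]
  simp only [gluedIntegrand, sqcdIntegrand, indexK, indexU, one_div, Finset.prod_inv_distrib,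
    theta_q_div] at h1 h2 ⊢
  rw [h1, h2]
  ring

lemma gluedIndex_eq (hq : ‖(q : ℂ)‖ < 1) (hn : 1 ≤ n) (ha : ∏ i, a i = 1) (hb : ∏ i, b i = 1)
    (hG : (sqcdChirals n b⁻¹ a y⁻¹ x).Generic q) {η : Fin n → ℝ}
    (hη : (sqcdChirals n b⁻¹ a y⁻¹ x).IsRegular η) :
    gluedIndex q n a b x y η = indexK q a b⁻¹ (x / y) := by
  have hb' : ∏ i, b⁻¹ i = 1 := by simp [hb]
  have := fun z => neBot_nearFilter (a := b⁻¹) (b := a) (x := y⁻¹) (y := x) (q := q) hn z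
  have hX := theta_pow_ne_zero_of_generic_right hq ha hG
  have hY := theta_pow_ne_zero_of_generic_left hq hb' hG
  have hindex := sqcdIndex_eq hq hn hb' ha hG hη
  rw [sqcdIndex] at hindex
  rw [gluedIndex, funext gluedIntegrand_eq, gluedChirals_eq, ChiralData.jkIntegral_reindex,
    ChiralData.jkIntegral_const_mul (jkWellDefined_sqcd hq hn hb' ha hG), mul_left_comm, hindex,
    indexK, theta_q_div, Finset.prod_comm]
  have h1 : ∀ i j, theta q (y⁻¹ * x * b⁻¹ j * a i) = theta q (x / y * a i * b⁻¹ j) := by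
    intro i j
    rw [div_eq_inv_mul, mul_right_comm]
  have h2 : y⁻¹ ^ (n + 1) * x ^ (n + 1) = (x / y) ^ (n + 1) := by
    rw [← mul_pow, div_eq_inv_mul]
  simp only [h1, h2]
  field_simp

end EllipticGenus

theorem mainTheorem4 (n : ℕ) (hn : 1 ≤ n) (q : ℂˣ) (hq : ‖(q : ℂ)‖ < 1)
    (a b : Fin (n + 1) → ℂˣ) (ha : ∏ i, a i = 1) (hb : ∏ i, b i = 1) (x y : ℂˣ) :
    ((EllipticGenus.sqcdChirals n a b x y).Generic q →
      (EllipticGenus.sqcdChirals n a b x y).JKWellDefined q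
          (EllipticGenus.sqcdIntegrand q n a b x y) ∧
        ∀ η : Fin n → ℝ, (EllipticGenus.sqcdChirals n a b x y).IsRegular η →
          EllipticGenus.sqcdIndex q n a b x y η =
            EllipticGenus.theta q (x ^ (n + 1) * y ^ (n + 1)) /
              (EllipticGenus.theta q (x ^ (n + 1)) * EllipticGenus.theta q (y ^ (n + 1)) *
                ∏ i, ∏ j, EllipticGenus.theta q (x * y * a i * b j))) ∧
    ((EllipticGenus.sqcdChirals n a b x y).Generic q →
      (EllipticGenus.sqcdChirals n a b y x).Generic q →
        ∀ η η' : Fin n → ℝ, (EllipticGenus.sqcdChirals n a b x y).IsRegular η →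
          (EllipticGenus.sqcdChirals n a b y x).IsRegular η' →
            EllipticGenus.sqcdIndex q n a b x y η = EllipticGenus.sqcdIndex q n a b y x η') ∧
    ((EllipticGenus.gluedChirals n a b x y).Generic q →
      (EllipticGenus.gluedChirals n a b x y).JKWellDefined q
          (EllipticGenus.gluedIntegrand q n a b x y) ∧
        ∀ η : Fin n → ℝ, (EllipticGenus.gluedChirals n a b x y).IsRegular η →
          EllipticGenus.gluedIndex q n a b x y η =
            EllipticGenus.indexK q a b⁻¹ (x / y)) := by
  open EllipticGenus in
  refine ⟨fun hG => ⟨jkWellDefined_sqcd hq hn ha hb hG, fun η hη =>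
    sqcdIndex_eq hq hn ha hb hG hη⟩, fun hG hG' η η' hη hη' => ?_, fun hG => ?_⟩
  · rw [sqcdIndex_eq hq hn ha hb hG hη, sqcdIndex_eq hq hn ha hb hG' hη',
      mul_comm (y ^ (n + 1)) (x ^ (n + 1)), mul_comm (theta q (y ^ (n + 1))), mul_comm y x]
  · rw [gluedChirals_eq] at hG ⊢
    have hG' := ChiralData.generic_of_generic_reindex hG
    refine ⟨?_, fun η hη => gluedIndex_eq hq hn ha hb hG'
      (ChiralData.isRegular_of_isRegular_reindex hη)⟩
    rw [funext gluedIntegrand_eq]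
    exact ((jkWellDefined_sqcd hq hn (by simp [hb]) ha hG').const_mul _).reindex
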